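/- Colorings are regarded as partitions: a $3$-coloring of a graph $X$ is a partition of $V(X)$ into three independent sets (some possibly empty), its color classes. The $3$-coloring complex $B(X)$ is the graph whose vertices are the color classes of all $3$-colorings of $X$, two distinct color classes being adjacent if they occur together in a $3$-coloring of $X$. The graph $X$ is reflexive if $v\mapsto\{C\in V(B(X)) : v\in C\}$ is a graph isomorphism from $X$ onto $B(B(X))$. A graph $G$ is edge-reflexive if it is $3$-edge-colorable and its line graph $L(G)$ is reflexive. Let $C_n'$ be the $n$-cycle with one half-edge attached at each vertex; in $L(C_n')$ two distinct edges or half-edges are adjacent if they share a vertex. **Theorem 4.1.** Let $n\ge 4$ be even, and let $\Pi_n = C_n\,\square\,K_2$ be the $n$-prism. Let $M$ be the set of the $n$ edges of $\Pi_n$ that join its two copies of $C_n$, let $A, B$ be the two perfect matchings of $C_n$, and let $A_0,A_1$ and $B_0,B_1$ be their copies in the first and the second $n$-cycle of $\Pi_n$. Then: 1. $\Pi_n$ is edge-reflexive. 2. The partition $\{M,\;A_0\cup B_1,\;B_0\cup A_1\}$ (the mixed coloring) is a $3$-coloring of $L(\Pi_n)$. Sending a color class $C$ of $L(C_n')$ to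 the set of edges of $\Pi_n$ consisting of both copies of each cycle edge in $C$ and of the edge of $M$ at $i$ for each vertex $i$ whose half-edge lies in $C$ is a well-defined embedding of $B(L(C_n'))$ into $B(L(\Pi_n))$, under which the set of all half-edges (a color class of $L(C_n')$) corresponds to $M$. Identifying $B(L(C_n'))$ with its image, $B(L(\Pi_n))$ is exactly $B(L(C_n'))$ together with one extra triangle on $M$, $A_0\cup B_1$, $B_0\cup A_1$, whose vertices other than $M$ are two new vertices, adjacent only to each other and to $M$. 3. $B(L(C_n'))$ has exactly $n$ $3$-colorings, each of them extends to exactly two $3$-colorings of $B(L(\Pi_n))$, and $B(L(\Pi_n))$ has exactly $2n$ $3$-colorings. -/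

import Mathlib

open SimpleGraph

namespace ColoringComplex

/-- The partition given by a coloring with `k` colors, as the set of its color classes
(some of which may be empty). -/
def classes {V : Type*} {X : SimpleGraph V} {k : ℕ} (c : X.Coloring (Fin k)) : Set (Set V) :=
  Set.range fun i => c.colorClass i

/-- The set of all `k`-colorings of `X`, regarded as partitions of `V(X)` into at most `k`
independent sets. -/
def colorings {V : Type*} (X : SimpleGraph V) (k : ℕ) : Set (Set (Set V)) :=
  Set.range fun c : X.Coloring (Fin k) => classes c

/-- The vertices of the `k`-coloring complex: the color classes of all `k`-colorings of `X`. -/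
abbrev ColorClass {V : Type*} (X : SimpleGraph V) (k : ℕ) : Type _ :=
  {S : Set V // ∃ P ∈ colorings X k, S ∈ P}

/-- The `k`-coloring complex `B(X)`: distinct color classes are adjacent when they appear together
in some `k`-coloring of `X`. -/
def complex {V : Type*} (X : SimpleGraph V) (k : ℕ) : SimpleGraph (ColorClass X k) where
  Adj C D := C ≠ D ∧ ∃ P ∈ colorings X k, C.1 ∈ P ∧ D.1 ∈ P
  symm := ⟨fun _ _ h => ⟨h.1.symm, h.2.imp fun _ hP => ⟨hP.1, hP.2.2, hP.2.1⟩⟩⟩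
  loopless := ⟨fun _ h => h.1 rfl⟩

/-- `X` is reflexive (for 3-colorings): the canonical map sending a vertex `v` to the set of all
color classes that contain `v` is an isomorphism from `X` onto `B(B(X))`. -/
def IsReflexive {V : Type*} (X : SimpleGraph V) : Prop :=
  ∃ φ : X ≃g complex (complex X 3) 3, ∀ v : V, (φ v).1 = {C : ColorClass X 3 | v ∈ C.1}

/-- A graph (without half-edges) is edge-reflexive if it is 3-edge-colorable and its line graph is
reflexive. -/
def IsEdgeReflexive {V : Type*} (G : SimpleGraph V) : Prop :=
  G.lineGraph.Colorable 3 ∧ IsReflexive G.lineGraph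

/-- The line graph of the graph obtained from `G` by attaching, for each `h : H`, one half-edge
at the vertex `a h`. -/
def halfEdgeLineGraph {V H : Type*} (G : SimpleGraph V) (a : H → V) :
    SimpleGraph (G.edgeSet ⊕ H) where
  Adj x y := x ≠ y ∧
    (Sum.elim (fun e : G.edgeSet => (e.1 : Set V)) (fun h => {a h}) x ∩
      Sum.elim (fun e : G.edgeSet => (e.1 : Set V)) (fun h => {a h}) y).Nonempty
  symm := ⟨fun _ _ h => ⟨h.1.symm, Set.inter_comm _ _ ▸ h.2⟩⟩
  loopless := ⟨fun _ h => h.1 rfl⟩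

/-- The line graph `L(Cₙ')` of the cubic `n`-cycle: the `n`-cycle with one half-edge at each
vertex. -/
abbrev cubicCycleLine (n : ℕ) : SimpleGraph ((cycleGraph n).edgeSet ⊕ Fin n) :=
  halfEdgeLineGraph (cycleGraph n) (id : Fin n → Fin n)

/-- The `n`-prism, the Cartesian product of an `n`-cycle and `K₂`. -/
abbrev prism (n : ℕ) : SimpleGraph (Fin n × Fin 2) :=
  cycleGraph n □ completeGraph (Fin 2)

/-- The copy of the edge `e` of the `n`-cycle in layer `b` of the prism. -/
def rim {n : ℕ} (b : Fin 2) (e : (cycleGraph n).edgeSet) : (prism n).edgeSet :=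
  ⟨e.1.map fun i => (i, b), by
    obtain ⟨e, he⟩ := e
    induction e using Sym2.ind with
    | _ u v =>
      simp only [Sym2.map_mk, mem_edgeSet, boxProd_adj] at he ⊢
      simpa using he⟩

/-- The edge of the prism that joins the two copies of the vertex `i` of the `n`-cycle. -/
def spoke {n : ℕ} (i : Fin n) : (prism n).edgeSet :=
  ⟨s((i, 0), (i, 1)), by simp [boxProd_adj]⟩

/-- The edges `{i, i + 1}` (indices modulo `n`) of the `n`-cycle with `i` even. For even `n`, this
set and its complement are the two perfect matchings of the `n`-cycle. -/
def evenEdges (n : ℕ) : Set (cycleGraph n).edgeSet :=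
  {e | ∃ i j : Fin n, Even i.val ∧ j.val = (i.val + 1) % n ∧ e.1 = s(i, j)}

/-- The perfect matching of the prism that consists of all spokes. -/
def spokes (n : ℕ) : Set (prism n).edgeSet := Set.range spoke

/-- The two remaining color classes of the mixed coloring of the prism: one of the perfect
matchings of the `n`-cycle in layer `0`, together with the other one in layer `1`. -/
def mixed (n : ℕ) : Fin 2 → Set (prism n).edgeSet
  | 0 => rim 0 '' evenEdges n ∪ rim 1 '' (evenEdges n)ᶜ
  | 1 => rim 0 '' (evenEdges n)ᶜ ∪ rim 1 '' evenEdges n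

/-- The graph `G` with one extra triangle, which consists of the vertex `v` of `G` and two new
vertices. -/
def addTriangle {V : Type*} (G : SimpleGraph V) (v : V) : SimpleGraph (V ⊕ Fin 2) where
  Adj
    | .inl a, .inl b => G.Adj a b
    | .inl a, .inr _ => a = v
    | .inr _, .inl b => b = v
    | .inr x, .inr y => x ≠ y
  symm := ⟨by
    rintro (a | x) (b | y) h
    · exact G.adj_symm h
    · exact h
    · exact h
    · exact Ne.symm h⟩
  loopless := ⟨by
    rintro (a | x) h
    · exact G.loopless.irrefl a h
    · exact h rfl⟩

/-- Let `j` place the vertices of `X` among those of `Y`. The 3-coloring `Q` of `Y` is an extension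
of the 3-coloring `P` of `X` if, for some matching of the color classes, each color class of `P` is
carried by `j` into the corresponding class of `Q`. -/
def Extends {V W : Type*} (X : SimpleGraph V) (Y : SimpleGraph W) (j : V → W)
    (P : Set (Set V)) (Q : Set (Set W)) : Prop :=
  ∃ (c : X.Coloring (Fin 3)) (d : Y.Coloring (Fin 3)), classes c = P ∧ classes d = Q ∧
    ∀ i, j '' c.colorClass i ⊆ d.colorClass i

end ColoringComplex

open ColoringComplex

/-! A color class contains exactly one of the three edges at a vertex `v` of a cubic graph. Coloring
each class by that edge gives a 3-coloring of the coloring complex, the star of `v`, whose color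
classes are the sets `{C | e ∈ C}` for the edges `e` at `v`. If the color classes separate the edges
and every 3-coloring of the complex is a star, then the line graph is reflexive
(`IsCubicLine.isReflexive`), and if moreover distinct vertices have distinct edge sets, the complex
has one 3-coloring per vertex. It remains to verify these conditions for the cycle with half-edges
and for the prism.

On the cycle, a class is determined by its matching of cycle edges, so a 3-coloring of the complex
is a function `g` that takes distinct values on the parts of any partition of the cycle into three
matchings. Let `A` be a perfect matching. Of the parts of any partition of `A` into three sets,
exactly one has color `g A`. These subsets of `A` thus behave like an ultrafilter on a finite set,
and they are the ones that contain a fixed edge `a` (`exists_dictator`). The complement of `A`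
yields an edge `b` in the same way. If `a` and `b` were disjoint, some coloring would put them in
one class, which would need both colors `g A` and `g Aᶜ`. So they share a vertex, and `g` is its
star (`exists_vertex`).

In the prism, the spoke at `i` forces both layers to use the same two colors at `i`. Going around,
the layers either agree everywhere, and the coloring is lifted from the cycle with half-edges, or
they are swapped at every step, which gives the mixed coloring (`prism_coloring_cases`). Hence the
complex gains one triangle at the class of spokes. A 3-coloring of the smaller complex, the star of
`i`, fixes the color of the spokes and leaves two ways to color the new vertices: the stars of `(i,
0)` and `(i, 1)`. -/

namespace ColoringComplex

/-! ### Stars of vertices and a criterion for reflexivity -/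

/-- `X` is the line graph of a cubic graph, possibly with half-edges: `inc v` lists the three
edges at the vertex `v`. -/
structure IsCubicLine {V E : Type*} (X : SimpleGraph E) (inc : V → Fin 3 → E) : Prop where
  inj : ∀ v, Function.Injective (inc v)
  adj : ∀ e e', X.Adj e e' ↔
    e ≠ e' ∧ ∃ v, e ∈ Set.range (inc v) ∧ e' ∈ Set.range (inc v)
  surj : ∀ e, ∃ v, e ∈ Set.range (inc v)

/-- A color class of a coloring, as a vertex of the coloring complex. -/
def toClass {V : Type*} {X : SimpleGraph V} {k : ℕ} (c : X.Coloring (Fin k)) (i : Fin k) :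
    ColorClass X k :=
  ⟨c.colorClass i, classes c, ⟨c, rfl⟩, i, rfl⟩

@[simp]
theorem mem_toClass {V : Type*} {X : SimpleGraph V} {k : ℕ} (c : X.Coloring (Fin k)) (i : Fin k)
    (v : V) : v ∈ (toClass c i).1 ↔ c v = i := Iff.rfl

theorem exists_eq_toClass {V : Type*} {X : SimpleGraph V} {k : ℕ} (C : ColorClass X k) :
    ∃ (c : X.Coloring (Fin k)) (i : Fin k), C = toClass c i := by
  obtain ⟨S, P, ⟨c, rfl⟩, i, rfl⟩ := C
  exact ⟨c, i, rfl⟩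

theorem complex_adj_iff {V : Type*} {X : SimpleGraph V} {k : ℕ} {C D : ColorClass X k} :
    (complex X k).Adj C D ↔
      C ≠ D ∧ ∃ (c : X.Coloring (Fin k)) (i j : Fin k), C = toClass c i ∧ D = toClass c j := by
  constructor
  · rintro ⟨hne, P, ⟨c, rfl⟩, ⟨i, hi⟩, ⟨j, hj⟩⟩
    exact ⟨hne, c, i, j, Subtype.ext hi.symm, Subtype.ext hj.symm⟩
  · rintro ⟨hne, c, i, j, rfl, rfl⟩
    exact ⟨hne, classes c, ⟨c, rfl⟩, ⟨i, rfl⟩, ⟨j, rfl⟩⟩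

namespace IsCubicLine

variable {V E : Type*} {X : SimpleGraph E} {inc : V → Fin 3 → E}

/-- An assignment of colors that is injective at each vertex is a coloring of the line graph. -/
def coloring (h : IsCubicLine X inc) (c : E → Fin 3)
    (hc : ∀ v, Function.Injective fun k => c (inc v k)) : X.Coloring (Fin 3) :=
  Coloring.mk c fun {e e'} hadj => by
    obtain ⟨hne, v, ⟨k, rfl⟩, ⟨l, rfl⟩⟩ := (h.adj e e').1 hadj
    exact fun heq => hne (congrArg _ (hc v heq))

theorem injective_coloring (h : IsCubicLine X inc) (c : X.Coloring (Fin 3)) (v : V) :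
    Function.Injective fun k => c (inc v k) := by
  intro k l hkl
  by_contra hne
  exact c.valid ((h.adj _ _).2 ⟨fun he => hne (h.inj v he), v, ⟨k, rfl⟩, ⟨l, rfl⟩⟩) hkl

/-- The three edges at `v` are pairwise adjacent in `X`, so a coloring uses each color once on them.
-/
theorem existsUnique_mem (h : IsCubicLine X inc) (v : V) (C : ColorClass X 3) :
    ∃! k, inc v k ∈ C.1 := by
  obtain ⟨c, i, rfl⟩ := exists_eq_toClass C
  have hb := Finite.injective_iff_bijective.1 (h.injective_coloring c v)
  exact hb.existsUnique i

theorem toClass_injective (h : IsCubicLine X inc) [Nonempty V] (c : X.Coloring (Fin 3)) :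
    Function.Injective (toClass c) := by
  intro i j hij
  obtain ⟨v⟩ := ‹Nonempty V›
  obtain ⟨k, hk⟩ :=
    (Finite.injective_iff_surjective.1 (h.injective_coloring c v)) i
  have : inc v k ∈ (toClass c j).1 := hij ▸ (mem_toClass c i _).2 hk
  exact hk.symm.trans this

/-- The 3-coloring of the coloring complex at a vertex `v`: each color class gets the color of its
unique edge at `v`. -/
noncomputable def star (h : IsCubicLine X inc) (v : V) : (complex X 3).Coloring (Fin 3) :=
  Coloring.mk (fun C => (h.existsUnique_mem v C).choose) fun {C D} hadj heq => by
    obtain ⟨hne, c, i, j, rfl, rfl⟩ := complex_adj_iff.1 hadj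
    have hi := (h.existsUnique_mem v (toClass c i)).choose_spec.1
    have hj := (h.existsUnique_mem v (toClass c j)).choose_spec.1
    rw [← heq] at hj
    exact hne (congrArg _ (((mem_toClass c i _).1 hi).symm.trans ((mem_toClass c j _).1 hj)))

theorem star_eq_iff (h : IsCubicLine X inc) (v : V) (C : ColorClass X 3) (k : Fin 3) :
    h.star v C = k ↔ inc v k ∈ C.1 := by
  have hs := (h.existsUnique_mem v C).choose_spec
  exact ⟨fun hk => hk ▸ hs.1, fun hk => (hs.2 k hk).symm⟩

theorem colorClass_star (h : IsCubicLine X inc) (v : V) (k : Fin 3) :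
    (h.star v).colorClass k = {C | inc v k ∈ C.1} :=
  Set.ext fun C => h.star_eq_iff v C k

theorem classes_star (h : IsCubicLine X inc) (v : V) :
    classes (h.star v) = Set.range fun k => {C : ColorClass X 3 | inc v k ∈ C.1} := by
  simp only [classes, colorClass_star]

/-- A 3-coloring of the coloring complex that only depends on the edge at `v` is the one at `v`. -/
theorem classes_eq_star (h : IsCubicLine X inc) (v : V) (f : (complex X 3).Coloring (Fin 3))
    (p : Fin 3 → Fin 3) (hp : Function.Injective p)
    (hf : ∀ C k, inc v k ∈ C.1 → f C = p k) : classes f = classes (h.star v) := by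
  have key : ∀ k, f.colorClass (p k) = (h.star v).colorClass k := by
    intro k
    ext C
    change f C = p k ↔ h.star v C = k
    obtain ⟨l, hl, -⟩ := h.existsUnique_mem v C
    rw [hf C l hl, hp.eq_iff, (h.star_eq_iff v C l).2 hl]
  have hs := Finite.injective_iff_surjective.1 hp
  ext S
  constructor
  · rintro ⟨i, rfl⟩
    obtain ⟨k, rfl⟩ := hs i
    exact ⟨k, (key k).symm⟩
  · rintro ⟨k, rfl⟩
    exact ⟨p k, key k⟩

/-- The classes of a star are the sets `{C | e ∈ C}` for the edges `e` at the vertex; by `hsep` they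
determine these edges. -/
theorem star_injective (h : IsCubicLine X inc)
    (hsep : Function.Injective fun e : E => {C : ColorClass X 3 | e ∈ C.1})
    (hinc : ∀ v w, Set.range (inc v) = Set.range (inc w) → v = w) :
    Function.Injective fun v => classes (h.star v) := by
  intro v w hvw
  simp only [classes_star] at hvw
  apply hinc
  apply (Set.image_injective.2 hsep)
  rw [← Set.range_comp, ← Set.range_comp]
  exact hvw

theorem colorings_complex (h : IsCubicLine X inc)
    (hstar : ∀ f : (complex X 3).Coloring (Fin 3), ∃ v, classes f = classes (h.star v)) :
    colorings (complex X 3) 3 = Set.range fun v => classes (h.star v) := by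
  ext P
  constructor
  · rintro ⟨f, rfl⟩
    obtain ⟨v, hv⟩ := hstar f
    exact ⟨v, hv.symm⟩
  · rintro ⟨v, rfl⟩
    exact ⟨h.star v, rfl⟩

theorem ncard_colorings_complex (h : IsCubicLine X inc)
    (hsep : Function.Injective fun e : E => {C : ColorClass X 3 | e ∈ C.1})
    (hinc : ∀ v w, Set.range (inc v) = Set.range (inc w) → v = w)
    (hstar : ∀ f : (complex X 3).Coloring (Fin 3), ∃ v, classes f = classes (h.star v)) :
    (colorings (complex X 3) 3).ncard = Nat.card V := by
  rw [h.colorings_complex hstar, ← Set.image_univ,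
    Set.ncard_image_of_injective _ (h.star_injective hsep hinc), Set.ncard_univ]

/-- As all 3-colorings of the complex are stars, the vertices of the double complex are exactly the
sets `{C | e ∈ C}`, and two of them are adjacent when their edges have a common vertex. -/
theorem isReflexive (h : IsCubicLine X inc)
    (hsep : Function.Injective fun e : E => {C : ColorClass X 3 | e ∈ C.1})
    (hstar : ∀ f : (complex X 3).Coloring (Fin 3), ∃ v, classes f = classes (h.star v)) :
    IsReflexive X := by
  have hmem : ∀ e : E, ∃ P ∈ colorings (complex X 3) 3, {C : ColorClass X 3 | e ∈ C.1} ∈ P := by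
    intro e
    obtain ⟨v, k, rfl⟩ := h.surj e
    exact ⟨_, ⟨h.star v, rfl⟩, k, h.colorClass_star v k⟩
  let φ : E → ColorClass (complex X 3) 3 := fun e => ⟨{C | e ∈ C.1}, hmem e⟩
  have hinj : Function.Injective φ := fun e e' he => hsep (congrArg Subtype.val he)
  have hsurj : Function.Surjective φ := by
    rintro ⟨S, P, hP, hS⟩
    rw [h.colorings_complex hstar] at hP
    obtain ⟨v, rfl⟩ := hP
    simp only [classes_star] at hS
    obtain ⟨k, rfl⟩ := hS
    exact ⟨inc v k, rfl⟩
  refine ⟨⟨Equiv.ofBijective φ ⟨hinj, hsurj⟩, ?_⟩, fun e => rfl⟩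
  intro e e'
  change (φ e ≠ φ e' ∧ ∃ P ∈ colorings (complex X 3) 3, 
    {C : ColorClass X 3 | e ∈ C.1} ∈ P ∧ {C : ColorClass X 3 | e' ∈ C.1} ∈ P) ↔ _
  rw [h.adj, hinj.ne_iff, h.colorings_complex hstar]
  refine and_congr_right fun _ => ?_
  simp only [Set.exists_range_iff, classes_star]
  refine exists_congr fun v => and_congr ?_ ?_
  · exact exists_congr fun k => hsep.eq_iff
  · exact exists_congr fun k => hsep.eq_iff

end IsCubicLine

/-! ### Three-colorings of the system of matchings of an even cycle -/

section CycleColorings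

/-- A color different from `x` and `y`. -/
def otherColor (x y : Fin 3) : Fin 3 := if x = y then x + 2 else -(x + y)

theorem otherColor_ne_left : ∀ x y, otherColor x y ≠ x := by decide

theorem otherColor_ne_right : ∀ x y, otherColor x y ≠ y := by decide

theorem eq_otherColor : ∀ {x y z : Fin 3}, x ≠ y → z ≠ x → z ≠ y → z = otherColor x y := by decide

variable {n : ℕ} [NeZero n]

/-- The colorings of the edges of the `n`-cycle, where `c i` is the color of the edge between the
vertices `i` and `i + 1`. -/
def IsCycleColoring (c : Fin n → Fin 3) : Prop := ∀ i, c i ≠ c (i + 1)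

/-- A function on sets of cycle edges that is a 3-coloring on the triangles of color classes. -/
def SeparatesClasses (g : Set (Fin n) → Fin 3) : Prop :=
  ∀ c : Fin n → Fin 3, IsCycleColoring c → ∀ k l, k ≠ l → g {i | c i = k} ≠ g {i | c i = l}

/-- `A` contains every other edge of the cycle. -/
def IsAlternating (A : Set (Fin n)) : Prop := ∀ i, i + 1 ∈ A ↔ i ∉ A

theorem IsAlternating.compl {A : Set (Fin n)} (hA : IsAlternating A) : IsAlternating Aᶜ := by
  intro i
  simp [hA i]

open Classical in
/-- The coloring of the cycle that extends a coloring of the edges in `A`. -/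
noncomputable def extendColoring (A : Set (Fin n)) (t : Fin n → Fin 3) (i : Fin n) : Fin 3 :=
  if i ∈ A then t i else otherColor (t (i - 1)) (t (i + 1))

/-- Both neighbors of an edge outside `A` lie in `A`, and `otherColor` avoids their two colors,
whatever they are. -/
theorem isCycleColoring_extendColoring {A : Set (Fin n)} (hA : IsAlternating A)
    (t : Fin n → Fin 3) : IsCycleColoring (extendColoring A t) := by
  intro i
  by_cases hi : i ∈ A
  · have h1 : i + 1 ∉ A := fun h => (hA i).1 h hi
    simp only [extendColoring, hi, h1, if_true, if_false, add_sub_cancel_right]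
    exact (otherColor_ne_left _ _).symm
  · have h1 : i + 1 ∈ A := (hA i).2 hi
    simp only [extendColoring, hi, h1, if_true, if_false]
    exact otherColor_ne_right _ _

namespace SeparatesClasses

variable {g : Set (Fin n) → Fin 3} {A : Set (Fin n)}

/-- A partition into three matchings gets three distinct colors. -/
theorem ne_of_partition (hg : SeparatesClasses g) {S T U : Set (Fin n)}
    (hST : Disjoint S T) (hSU : Disjoint S U) (hTU : Disjoint T U) (hun : ∀ i, i ∈ S ∨ i ∈ T ∨ i ∈ U)
    (hS : ∀ i ∈ S, i + 1 ∉ S) (hT : ∀ i ∈ T, i + 1 ∉ T) (hU : ∀ i ∈ U, i + 1 ∉ U) :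
    g S ≠ g T ∧ g S ≠ g U ∧ g T ≠ g U := by
  classical
  rw [Set.disjoint_left] at hST hSU hTU
  let c : Fin n → Fin 3 := fun i => if i ∈ S then 0 else if i ∈ T then 1 else 2
  have h0 : {i | c i = 0} = S := by
    ext i
    have := @hST i; have := @hSU i; have := @hTU i; have := hun i
    by_cases h1 : i ∈ S <;> by_cases h2 : i ∈ T <;> simp_all [c]
  have h1 : {i | c i = 1} = T := by
    ext i
    have := @hST i; have := @hSU i; have := @hTU i; have := hun i
    by_cases h1 : i ∈ S <;> by_cases h2 : i ∈ T <;> simp_all [c]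
  have h2 : {i | c i = 2} = U := by
    ext i
    have := @hST i; have := @hSU i; have := @hTU i; have := hun i
    by_cases h1 : i ∈ S <;> by_cases h2 : i ∈ T <;> simp_all [c]
  have hc : IsCycleColoring c := by
    intro i hi
    rcases hun i with h | h | h
    · have e : c i = 0 := by rw [← h0] at h; exact h
      have : i + 1 ∈ {i | c i = 0} := hi.symm.trans e
      exact hS i h (h0 ▸ this)
    · have e : c i = 1 := by rw [← h1] at h; exact h
      have : i + 1 ∈ {i | c i = 1} := hi.symm.trans e
      exact hT i h (h1 ▸ this)
    · have e : c i = 2 := by rw [← h2] at h; exact h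
      have : i + 1 ∈ {i | c i = 2} := hi.symm.trans e
      exact hU i h (h2 ▸ this)
  have h01 := hg c hc 0 1 (by decide)
  have h02 := hg c hc 0 2 (by decide)
  have h12 := hg c hc 1 2 (by decide)
  rw [h0, h1] at h01
  rw [h0, h2] at h02
  rw [h1, h2] at h12
  exact ⟨h01, h02, h12⟩

/-- The color of a matching is that of `A` exactly if this holds for its part in `A`. -/
theorem eq_iff_inter_eq (hg : SeparatesClasses g) (hA : IsAlternating A) {M : Set (Fin n)}
    (hM : ∀ i ∈ M, i + 1 ∉ M) : g M = g A ↔ g (M ∩ A) = g A := by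
  have hA' : ∀ i, i + 1 ∈ A ↔ i ∉ A := hA
  -- Let `A`, `Aᶜ`, `∅` have colors 0, 1, 2 (fourth partition). By the second partition, `M ∩ A` and
  -- `A \ M` have colors 0 and 2 in some order; by the third, `Aᶜ \ M` does not have color 0. So by
  -- the first, `M` has color 0 exactly if `A \ M` does not, that is, if `M ∩ A` does.
  obtain ⟨a1, a2, a3⟩ := hg.ne_of_partition (S := M) (T := A \ M) (U := Aᶜ \ M)
    (by grind) (by grind) (by grind)
    (by grind) hM (by grind) (by grind)
  obtain ⟨b1, b2, b3⟩ := hg.ne_of_partition (S := M ∩ A) (T := A \ M) (U := Aᶜ)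
    (by grind) (by grind) (by grind)
    (by grind) (by grind) (by grind) (by grind)
  obtain ⟨c1, c2, c3⟩ := hg.ne_of_partition (S := M ∩ Aᶜ) (T := Aᶜ \ M) (U := A)
    (by grind) (by grind) (by grind)
    (by grind) (by grind) (by grind) (by grind)
  obtain ⟨d1, d2, d3⟩ := hg.ne_of_partition (S := A) (T := Aᶜ) (U := ∅)
    (by grind) (by grind) (by grind)
    (by grind) (by grind) (by grind) (by grind)
  clear hM hA hA'
  generalize g M = x1 at *
  generalize g (M ∩ A) = x2 at *
  generalize g (A \ M) = x3 at *
  generalize g (Aᶜ \ M) = x4 at *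
  generalize g A = x5 at *
  generalize g Aᶜ = x6 at *
  generalize g ∅ = x7 at *
  grind

/-- Of the three parts of a partition of `A`, exactly one has the color of `A`. -/
theorem existsUnique_part (hg : SeparatesClasses g) (hA : IsAlternating A) (t : Fin n → Fin 3) :
    ∃! k, g {i | i ∈ A ∧ t i = k} = g A := by
  have hc := isCycleColoring_extendColoring hA t
  have hinj : Function.Injective fun k => g {i | extendColoring A t i = k} := by
    intro k l hkl
    by_contra hne
    exact hg _ hc k l hne hkl
  have hb := Finite.injective_iff_bijective.1 hinj
  obtain ⟨k, hk, huniq⟩ := hb.existsUnique (g A)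
  -- A class of the extended coloring may be cut down to `A` without affecting whether it has the
  -- color of `A`.
  have key : ∀ l, g {i | extendColoring A t i = l} = g A ↔ g {i | i ∈ A ∧ t i = l} = g A := by
    intro l
    rw [hg.eq_iff_inter_eq hA (fun i hi hi' => hc i (hi.trans hi'.symm))]
    have : {i | extendColoring A t i = l} ∩ A = {i | i ∈ A ∧ t i = l} := by
      ext i
      by_cases hi : i ∈ A <;> simp [extendColoring, hi]
    rw [this]
  exact ⟨k, (key k).1 hk, fun l hl => huniq l ((key l).2 hl)⟩

theorem part_cases (hg : SeparatesClasses g) (hA : IsAlternating A) {S T U : Set (Fin n)}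
    (hST : Disjoint S T) (hSU : Disjoint S U) (hTU : Disjoint T U) (hun : S ∪ T ∪ U = A) :
    (g S = g A ∧ g T ≠ g A ∧ g U ≠ g A) ∨ (g S ≠ g A ∧ g T = g A ∧ g U ≠ g A) ∨
      (g S ≠ g A ∧ g T ≠ g A ∧ g U = g A) := by
  classical
  rw [Set.disjoint_left] at hST hSU hTU
  let t : Fin n → Fin 3 := fun i => if i ∈ S then 0 else if i ∈ T then 1 else 2
  have hmem : ∀ i, i ∈ A ↔ i ∈ S ∨ i ∈ T ∨ i ∈ U := by
    intro i
    simp [← hun, or_assoc]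
  have h0 : {i | i ∈ A ∧ t i = 0} = S := by
    ext i
    have := @hST i; have := @hSU i; have := @hTU i; have := hmem i
    by_cases h1 : i ∈ S <;> by_cases h2 : i ∈ T <;> simp_all [t]
  have h1 : {i | i ∈ A ∧ t i = 1} = T := by
    ext i
    have := @hST i; have := @hSU i; have := @hTU i; have := hmem i
    by_cases h1 : i ∈ S <;> by_cases h2 : i ∈ T <;> simp_all [t]
  have h2 : {i | i ∈ A ∧ t i = 2} = U := by
    ext i
    have := @hST i; have := @hSU i; have := @hTU i; have := hmem i
    by_cases h1 : i ∈ S <;> by_cases h2 : i ∈ T <;> simp_all [t]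
  obtain ⟨k, hk, huniq⟩ := hg.existsUnique_part hA t
  have u0 := huniq 0
  have u1 := huniq 1
  have u2 := huniq 2
  simp only [h0] at u0
  simp only [h1] at u1
  simp only [h2] at u2
  fin_cases k
  · exact Or.inl ⟨h0 ▸ hk, fun h => absurd (u1 h) (by decide), fun h => absurd (u2 h) (by decide)⟩
  · exact Or.inr (Or.inl
      ⟨fun h => absurd (u0 h) (by decide), h1 ▸ hk, fun h => absurd (u2 h) (by decide)⟩)
  · exact Or.inr (Or.inr
      ⟨fun h => absurd (u0 h) (by decide), fun h => absurd (u1 h) (by decide), h2 ▸ hk⟩)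

/-- In the partition `A`, `∅`, `∅` only one part may have the color of `A`. -/
theorem empty_ne (hg : SeparatesClasses g) (hA : IsAlternating A) : g ∅ ≠ g A := by
  rcases hg.part_cases hA (S := A) (T := ∅) (U := ∅) (by simp) (by simp) (by simp) (by simp)
    with h | h | h
  · exact h.2.1
  · exact absurd rfl h.1
  · exact absurd rfl h.1

/-- An ultrafilter on a finite set is principal: when one element is split off from `T`, either it
or the rest keeps the color of `A`, and the process stops since `∅` has another color. -/
theorem exists_singleton (hg : SeparatesClasses g) (hA : IsAlternating A) (T : Set (Fin n))
    (hTA : T ⊆ A) (hT : g T = g A) : ∃ a ∈ A, g {a} = g A := by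
  induction hN : T.ncard using Nat.strong_induction_on generalizing T with
  | _ N ih =>
    have hne : T.Nonempty := by
      by_contra h
      rw [Set.not_nonempty_iff_eq_empty] at h
      exact hg.empty_ne hA (h ▸ hT)
    obtain ⟨a, ha⟩ := hne
    have h1 : g (A \ T) ≠ g A := by
      rcases hg.part_cases hA (S := T) (T := A \ T) (U := ∅) (by grind)
        (by simp) (by simp) (by grind) with h | h | h
      · exact h.2.1
      · exact absurd hT h.1
      · exact absurd hT h.1
    rcases hg.part_cases hA (S := {a}) (T := T \ {a}) (U := A \ T) (by grind)
      (by grind) (by grind) (by grind) with h | h | h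
    · exact ⟨a, hTA ha, h.1⟩
    · refine ih _ ?_ (T \ {a}) (Set.sdiff_subset.trans hTA) h.2.1 rfl
      rw [← hN]
      exact Set.ncard_sdiff_singleton_lt_of_mem ha
    · exact absurd h.2.2 h1

/-- Some edge in `A` dictates which color classes have the color of `A`. -/
theorem exists_dictator (hg : SeparatesClasses g) (hA : IsAlternating A) :
    ∃ a ∈ A, ∀ c : Fin n → Fin 3, IsCycleColoring c → g {i | c i = c a} = g A := by
  obtain ⟨a, haA, ha⟩ := hg.exists_singleton hA A subset_rfl rfl
  refine ⟨a, haA, fun c hc => ?_⟩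
  rw [hg.eq_iff_inter_eq hA (fun i hi hi' => hc i (hi.trans hi'.symm))]
  set T := {i | c i = c a} ∩ A with hTdef
  have haT : a ∈ T := ⟨rfl, haA⟩
  have hTA : T ⊆ A := Set.inter_subset_right
  -- `{a}` already has the color of `A`, so the disjoint set `A \ T` does not. Since `∅` does not
  -- either, `T` must.
  have h1 : g (A \ T) ≠ g A := by
    rcases hg.part_cases hA (S := {a}) (T := T \ {a}) (U := A \ T) (by grind)
      (by grind) (by grind) (by grind) with h | h | h
    · exact h.2.2
    · exact absurd ha h.1
    · exact absurd ha h.1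
  rcases hg.part_cases hA (S := T) (T := A \ T) (U := ∅) (by grind)
      (by simp) (by simp) (by grind) with h | h | h
  · exact h.1
  · exact absurd h.2.1 h1
  · exact absurd h.2.2 (hg.empty_ne hA)

/-- A 3-coloring of the color classes of the cycle is dictated by one vertex. -/
theorem exists_vertex (hg : SeparatesClasses g) (hA : IsAlternating A) :
    ∃ i p q, p ≠ q ∧ ∀ c : Fin n → Fin 3, IsCycleColoring c →
      g {j | c j = c i} = p ∧ g {j | c j = c (i - 1)} = q := by
  classical
  obtain ⟨a, haA, ha⟩ := hg.exists_dictator hA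
  obtain ⟨b, hbA, hb⟩ := hg.exists_dictator hA.compl
  have hne : g A ≠ g Aᶜ := by
    have hA' : ∀ i, i + 1 ∈ A ↔ i ∉ A := hA
    exact (hg.ne_of_partition (S := A) (T := Aᶜ) (U := ∅) (by grind)
      (by simp) (by simp) (by grind) (by grind) (by grind) (by simp)).1
  -- Otherwise give `a` color 0 and the rest of `A` color 1. Both neighbors of `b` then have color
  -- 1, and `otherColor 1 1 = 0` puts `b` into the class of `a`.
  have hadj : b - 1 = a ∨ b + 1 = a := by
    by_contra! h
    let t : Fin n → Fin 3 := fun i => if i = a then 0 else 1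
    have hc := isCycleColoring_extendColoring hA t
    have e1 : extendColoring A t a = 0 := by simp [extendColoring, haA, t]
    have e2 : extendColoring A t b = 0 := by
      have hb' : b ∉ A := hbA
      simp only [extendColoring, hb', t, h.1, h.2, if_false]
      decide
    have ha' := ha _ hc
    have hb' := hb _ hc
    rw [e1] at ha'
    rw [e2] at hb'
    exact hne (ha'.symm.trans hb')
  rcases hadj with h | h
  · exact ⟨b, g Aᶜ, g A, hne.symm, fun c hc => ⟨hb c hc, h ▸ ha c hc⟩⟩
  · refine ⟨a, g A, g Aᶜ, hne, fun c hc => ⟨ha c hc, ?_⟩⟩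
    rw [← h, add_sub_cancel_right]
    exact hb c hc

end SeparatesClasses

end CycleColorings

/-! ### The line graph of the cycle with half-edges and its coloring complex -/

section Cycle

variable {n : ℕ} [NeZero n]

theorem fin_one_val (hn : 2 ≤ n) : (1 : Fin n).val = 1 := by
  rw [Fin.val_one', Nat.mod_eq_of_lt hn]

theorem fin_add_one_val (hn : 2 ≤ n) (i : Fin n) : (i + 1).val = (i.val + 1) % n := by
  rw [Fin.val_add, fin_one_val hn]

theorem fin_add_one_ne (hn : 2 ≤ n) (i : Fin n) : i + 1 ≠ i := by
  intro h
  have : (1 : Fin n) = 0 := by simpa using h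
  have := congrArg Fin.val this
  rw [fin_one_val hn, Fin.val_zero] at this
  exact one_ne_zero this

theorem fin_add_two_ne (hn : 3 ≤ n) (i : Fin n) : i + 1 + 1 ≠ i := by
  intro h
  have h2 : (1 : Fin n) + 1 = 0 := by simpa [add_assoc] using h
  have := congrArg Fin.val h2
  rw [fin_add_one_val (by omega), fin_one_val (by omega), Fin.val_zero,
    Nat.mod_eq_of_lt (by omega)] at this
  omega

theorem cycleGraph_adj_iff (hn : 2 ≤ n) (i j : Fin n) :
    (cycleGraph n).Adj i j ↔ j = i + 1 ∨ i = j + 1 := by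
  have key : ∀ i j : Fin n, (i - j).val = 1 ↔ i = j + 1 := by
    intro i j
    rw [← fin_one_val hn, ← Fin.ext_iff, sub_eq_iff_eq_add']
  rw [cycleGraph_adj', key, key, or_comm]

/-- Evenness of `n` is what makes the parity alternate across the step from `n - 1` to `0`. -/
theorem isAlternating_even (hn : 2 ≤ n) (hev : Even n) :
    IsAlternating {i : Fin n | Even i.val} := by
  intro i
  simp only [Set.mem_ofPred_eq, fin_add_one_val hn]
  rw [Nat.even_iff, Nat.mod_mod_of_dvd _ hev.two_dvd, Nat.even_iff]
  omega

/-- The edge of the cycle between the vertices `i` and `i + 1`. -/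
def cycleEdge (hn : 3 ≤ n) (i : Fin n) : (cycleGraph n).edgeSet :=
  ⟨s(i, i + 1), (cycleGraph_adj_iff (by omega) _ _).2 (Or.inl rfl)⟩

theorem cycleEdge_eq_iff (hn : 3 ≤ n) (i j : Fin n) :
    cycleEdge hn i = cycleEdge hn j ↔ i = j ∧ i + 1 = j + 1 ∨ i = j + 1 ∧ i + 1 = j :=
  Subtype.ext_iff.trans Sym2.eq_iff

theorem mem_cycleEdge (hn : 3 ≤ n) (i v : Fin n) :
    v ∈ (cycleEdge hn i).1 ↔ cycleEdge hn i = cycleEdge hn v ∨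
      cycleEdge hn i = cycleEdge hn (v - 1) := by
  rw [cycleEdge_eq_iff, cycleEdge_eq_iff, sub_add_cancel]
  refine Sym2.mem_iff.trans ?_
  constructor
  · rintro (rfl | rfl) <;> simp
  · rintro ((h | h) | h | h)
    · exact Or.inl h.1.symm
    · exact Or.inr h.2.symm
    · exact Or.inr h.2.symm
    · exact Or.inl h.1.symm

theorem cycleEdge_injective (hn : 3 ≤ n) : Function.Injective (cycleEdge hn) := by
  intro i j h
  rw [cycleEdge_eq_iff] at h
  rcases h with h | ⟨h, h'⟩
  · exact h.1
  · exact absurd (h ▸ h') (fin_add_two_ne hn j)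

theorem cycleEdge_surjective (hn : 3 ≤ n) : Function.Surjective (cycleEdge hn) := by
  rintro ⟨e, he⟩
  induction e using Sym2.ind with
  | _ u v =>
    have h : v = u + 1 ∨ u = v + 1 := (cycleGraph_adj_iff (by omega) _ _).1 he
    rcases h with rfl | rfl
    · exact ⟨u, rfl⟩
    · exact ⟨v, Subtype.ext Sym2.eq_swap⟩

/-- The edges of the cycle, indexed by their first vertices. -/
noncomputable def cycleEdgeEquiv (hn : 3 ≤ n) : Fin n ≃ (cycleGraph n).edgeSet :=
  Equiv.ofBijective (cycleEdge hn) ⟨cycleEdge_injective hn, cycleEdge_surjective hn⟩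

theorem cycleEdge_mem_evenEdges (hn : 3 ≤ n) (i : Fin n) :
    cycleEdge hn i ∈ evenEdges n ↔ Even i.val := by
  constructor
  · rintro ⟨u, v, hu, hv, h⟩
    have : v = u + 1 := Fin.ext (by rw [hv, fin_add_one_val (by omega)])
    subst this
    have : cycleEdge hn i = cycleEdge hn u := Subtype.ext h
    rwa [cycleEdge_injective hn this]
  · intro h
    exact ⟨i, i + 1, h, fin_add_one_val (by omega) i, rfl⟩

/-- The three edges at a vertex of the cycle with half-edges. -/
def cycleInc (hn : 3 ≤ n) (i : Fin n) : Fin 3 → (cycleGraph n).edgeSet ⊕ Fin n :=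
  ![Sum.inl (cycleEdge hn i), Sum.inl (cycleEdge hn (i - 1)), Sum.inr i]

theorem mem_range_fin_three {α : Type*} {x a b c : α} :
    x ∈ Set.range ![a, b, c] ↔ x = a ∨ x = b ∨ x = c := by
  simp [or_comm, or_left_comm]

theorem injective_fin_three {α : Type*} {a b c : α} (hab : a ≠ b) (hac : a ≠ c) (hbc : b ≠ c) :
    Function.Injective ![a, b, c] := by
  intro i j
  fin_cases i <;> fin_cases j <;> simp [hab, hac, hbc, hab.symm, hac.symm, hbc.symm]

theorem sub_one_ne (hn : 2 ≤ n) (i : Fin n) : i - 1 ≠ i := by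
  intro h
  have := fin_add_one_ne hn (i - 1)
  rw [sub_add_cancel] at this
  exact this h.symm

theorem isCubicLine_cycle (hn : 3 ≤ n) : IsCubicLine (cubicCycleLine n) (cycleInc hn) where
  inj i := injective_fin_three
    (fun h => sub_one_ne (by omega) i (cycleEdge_injective hn (Sum.inl_injective h)).symm)
    (by simp) (by simp)
  adj x y := by
    have key : ∀ (x : (cycleGraph n).edgeSet ⊕ Fin n) (v : Fin n),
        v ∈ Sum.elim (fun e : (cycleGraph n).edgeSet => (e.1 : Set (Fin n)))
          (fun h : Fin n => {id h}) x ↔ x ∈ Set.range (cycleInc hn v) := by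
      rintro (e | h) v
      · obtain ⟨i, rfl⟩ := cycleEdge_surjective hn e
        rw [cycleInc, mem_range_fin_three]
        simpa using mem_cycleEdge hn i v
      · rw [cycleInc, mem_range_fin_three]
        simp [eq_comm]
    change (x ≠ y ∧ _) ↔ _
    simp only [Set.Nonempty, Set.mem_inter_iff, key]
  surj x := by
    rcases x with e | h
    · obtain ⟨i, rfl⟩ := cycleEdge_surjective hn e
      exact ⟨i, 0, rfl⟩
    · exact ⟨h, 2, rfl⟩

theorem cycleInc_range_injective (hn : 3 ≤ n) (i j : Fin n)
    (h : Set.range (cycleInc hn i) = Set.range (cycleInc hn j)) : i = j := by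
  have : Sum.inr i ∈ Set.range (cycleInc hn j) := h ▸ ⟨2, rfl⟩
  rw [cycleInc, mem_range_fin_three] at this
  simpa using this

/-- The color of the half-edges and edges in the coloring determined by the colors of the cycle. -/
noncomputable def cycleColor (hn : 3 ≤ n) (c : Fin n → Fin 3) :
    (cycleGraph n).edgeSet ⊕ Fin n → Fin 3 :=
  Sum.elim (fun e => c ((cycleEdgeEquiv hn).symm e)) fun i => otherColor (c i) (c (i - 1))

@[simp]
theorem cycleColor_cycleEdge (hn : 3 ≤ n) (c : Fin n → Fin 3) (i : Fin n) :
    cycleColor hn c (Sum.inl (cycleEdge hn i)) = c i :=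
  congrArg c ((cycleEdgeEquiv hn).symm_apply_apply i)

@[simp]
theorem cycleColor_inr (hn : 3 ≤ n) (c : Fin n → Fin 3) (i : Fin n) :
    cycleColor hn c (Sum.inr i) = otherColor (c i) (c (i - 1)) := rfl

theorem IsCycleColoring.injective_cycleColor (hn : 3 ≤ n) {c : Fin n → Fin 3}
    (hc : IsCycleColoring c) (i : Fin n) :
    Function.Injective fun k => cycleColor hn c (cycleInc hn i k) := by
  have : (fun k => cycleColor hn c (cycleInc hn i k)) =
      ![c i, c (i - 1), otherColor (c i) (c (i - 1))] := by
    ext k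
    fin_cases k <;> simp [cycleInc]
  rw [this]
  refine injective_fin_three ?_ (otherColor_ne_left _ _).symm (otherColor_ne_right _ _).symm
  have := hc (i - 1)
  rw [sub_add_cancel] at this
  exact this.symm

/-- The coloring of the line graph of the cycle with half-edges that is determined by the colors
of the cycle edges. -/
noncomputable def cycleColoring (hn : 3 ≤ n) (c : Fin n → Fin 3) (hc : IsCycleColoring c) :
    (cubicCycleLine n).Coloring (Fin 3) :=
  (isCubicLine_cycle hn).coloring (cycleColor hn c) (hc.injective_cycleColor hn)

/-- The restriction of a coloring to the cycle edges. -/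
def cycleRestrict (hn : 3 ≤ n) (c : (cubicCycleLine n).Coloring (Fin 3)) (i : Fin n) : Fin 3 :=
  c (Sum.inl (cycleEdge hn i))

theorem isCycleColoring_cycleRestrict (hn : 3 ≤ n) (c : (cubicCycleLine n).Coloring (Fin 3)) :
    IsCycleColoring (cycleRestrict hn c) := by
  intro i h
  have := (isCubicLine_cycle hn).injective_coloring c (i + 1)
  have h01 : (1 : Fin 3) = 0 := this (by simpa [cycleInc, cycleRestrict] using h)
  exact absurd h01 (by decide)

/-- The color of a half-edge is forced: it is the one missing from the two cycle edges at its
vertex. -/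
theorem cycleColor_cycleRestrict (hn : 3 ≤ n) (c : (cubicCycleLine n).Coloring (Fin 3))
    (x : (cycleGraph n).edgeSet ⊕ Fin n) : cycleColor hn (cycleRestrict hn c) x = c x := by
  rcases x with e | i
  · obtain ⟨i, rfl⟩ := cycleEdge_surjective hn e
    simp [cycleRestrict]
  · have hinj := (isCubicLine_cycle hn).injective_coloring c i
    refine (eq_otherColor ?_ ?_ ?_).symm
    · exact fun h => absurd (hinj (a₁ := 0) (a₂ := 1) h) (by decide)
    · exact fun h => absurd (hinj (a₁ := 2) (a₂ := 0) h) (by decide)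
    · exact fun h => absurd (hinj (a₁ := 2) (a₂ := 1) h) (by decide)

theorem cycleColoring_cycleRestrict (hn : 3 ≤ n) (c : (cubicCycleLine n).Coloring (Fin 3)) :
    cycleColoring hn (cycleRestrict hn c) (isCycleColoring_cycleRestrict hn c) = c :=
  RelHom.ext fun x => cycleColor_cycleRestrict hn c x

/-- A matching of the cycle together with the half-edges at the uncovered vertices. -/
def fullClass (hn : 3 ≤ n) (S : Set (Fin n)) : Set ((cycleGraph n).edgeSet ⊕ Fin n) :=
  Sum.inl '' (cycleEdge hn '' S) ∪ Sum.inr '' {i | i ∉ S ∧ i - 1 ∉ S}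

theorem colorClass_cycleColoring (hn : 3 ≤ n) (c : Fin n → Fin 3) (hc : IsCycleColoring c)
    (k : Fin 3) : (cycleColoring hn c hc).colorClass k = fullClass hn {i | c i = k} := by
  ext x
  change cycleColor hn c x = k ↔ _
  rcases x with e | i
  · obtain ⟨i, rfl⟩ := cycleEdge_surjective hn e
    simp [fullClass, (cycleEdge_injective hn).eq_iff]
  · simp only [fullClass, cycleColor_inr, Set.mem_union, Set.mem_image, Set.mem_ofPred_eq]
    have h1 := otherColor_ne_left (c i) (c (i - 1))
    have h2 := otherColor_ne_right (c i) (c (i - 1))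
    have h3 : c i ≠ c (i - 1) := by
      have := hc (i - 1)
      rw [sub_add_cancel] at this
      exact this.symm
    have h4 := @eq_otherColor _ _ k h3
    simp only [reduceCtorEq, and_false, exists_false, false_or, Sum.inr.injEq, exists_eq_right]
    constructor
    · rintro rfl
      exact ⟨h1.symm, h2.symm⟩
    · rintro ⟨ha, hb⟩
      exact (h4 (Ne.symm ha) (Ne.symm hb)).symm

theorem exists_cycleColoring (hn : 3 ≤ n) (C : ColorClass (cubicCycleLine n) 3) :
    ∃ c hc k, C = toClass (cycleColoring hn c hc) k := by
  obtain ⟨c, k, rfl⟩ := exists_eq_toClass C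
  exact ⟨cycleRestrict hn c, isCycleColoring_cycleRestrict hn c, k,
    by rw [cycleColoring_cycleRestrict]⟩

open Classical in
/-- Every 3-coloring of the coloring complex of the cycle with half-edges comes from a vertex. -/
theorem cycle_classes_eq_star (hn : 3 ≤ n) (hev : Even n)
    (f : (complex (cubicCycleLine n) 3).Coloring (Fin 3)) :
    ∃ (i : Fin n) (p : Fin 3 → Fin 3), Function.Injective p ∧
      ∀ C k, cycleInc hn i k ∈ C.1 → f C = p k := by
  let X := cubicCycleLine n
  -- The default 0 plays no role: `SeparatesClasses` only concerns classes of cycle colorings, where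
  -- the first branch applies by `hval`.
  let g : Set (Fin n) → Fin 3 := fun S =>
    if h : ∃ P ∈ colorings X 3, fullClass hn S ∈ P then f ⟨fullClass hn S, h⟩ else 0
  have hval : ∀ c hc k, f (toClass (cycleColoring hn c hc) k) = g {i | c i = k} := by
    intro c hc k
    have h : ∃ P ∈ colorings X 3, fullClass hn {i | c i = k} ∈ P :=
      colorClass_cycleColoring hn c hc k ▸ (toClass (cycleColoring hn c hc) k).2
    simp only [g, dif_pos h]
    exact congrArg f (Subtype.ext (colorClass_cycleColoring hn c hc k))
  have hg : SeparatesClasses g := by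
    intro c hc k l hkl
    rw [← hval c hc, ← hval c hc]
    exact f.valid (complex_adj_iff.2
      ⟨((isCubicLine_cycle hn).toClass_injective _).ne hkl, _, k, l, rfl, rfl⟩)
  obtain ⟨i, p, q, hpq, hdict⟩ := hg.exists_vertex (isAlternating_even (by omega) hev)
  refine ⟨i, ![p, q, otherColor p q], injective_fin_three hpq (otherColor_ne_left _ _).symm
    (otherColor_ne_right _ _).symm, ?_⟩
  intro C k hk
  obtain ⟨c, hc, l, rfl⟩ := exists_cycleColoring hn C
  have h0 : f (toClass (cycleColoring hn c hc) (c i)) = p := (hval c hc _).trans (hdict c hc).1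
  have h1 : f (toClass (cycleColoring hn c hc) (c (i - 1))) = q :=
    (hval c hc _).trans (hdict c hc).2
  have hk' : cycleColor hn c (cycleInc hn i k) = l := hk
  subst hk'
  fin_cases k
  · simpa [cycleInc] using h0
  · simpa [cycleInc] using h1
  -- The class of the half-edge at `i` forms a triangle with the classes of the two cycle edges
  -- there, so it gets the third color.
  · have hne : ∀ a b, a ≠ b → f (toClass (cycleColoring hn c hc) a) ≠
        f (toClass (cycleColoring hn c hc) b) := fun a b hab =>
      f.valid (complex_adj_iff.2
        ⟨((isCubicLine_cycle hn).toClass_injective _).ne hab, _, a, b, rfl, rfl⟩)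
    refine eq_otherColor hpq ?_ ?_
    · rw [← h0]
      exact hne _ _ (by simpa [cycleInc] using otherColor_ne_left _ _)
    · rw [← h1]
      exact hne _ _ (by simpa [cycleInc] using otherColor_ne_right _ _)

end Cycle

/-! ### Color classes separate the edges and half-edges of the cycle -/

section Separation

variable {n : ℕ} [NeZero n]

@[simp]
theorem inl_mem_fullClass (hn : 3 ≤ n) (S : Set (Fin n)) (i : Fin n) :
    Sum.inl (cycleEdge hn i) ∈ fullClass hn S ↔ i ∈ S := by
  simp [fullClass, (cycleEdge_injective hn).eq_iff]

@[simp]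
theorem inr_mem_fullClass (hn : 3 ≤ n) (S : Set (Fin n)) (i : Fin n) :
    Sum.inr i ∈ fullClass hn S ↔ i ∉ S ∧ i - 1 ∉ S := by
  simp [fullClass]

/-- The set of all half-edges is a color class. -/
theorem exists_halfEdgeClass (hn : 3 ≤ n) (hev : Even n) :
    ∃ C : ColorClass (cubicCycleLine n) 3, C.1 = Set.range Sum.inr := by
  have hA := isAlternating_even (n := n) (by omega) hev
  let c : Fin n → Fin 3 := fun i => if Even i.val then 0 else 1
  have hc : IsCycleColoring c := by
    intro i
    have h : Even (i + 1).val ↔ ¬ Even i.val := hA i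
    by_cases hi : Even i.val <;> simp [c, h, hi]
  refine ⟨toClass (cycleColoring hn c hc) 2, ?_⟩
  refine (colorClass_cycleColoring hn c hc 2).trans ?_
  have : {i | c i = 2} = ∅ := by
    ext i
    by_cases hi : Even i.val <;> simp [c, hi]
  rw [this]
  ext x
  rcases x with e | i
  · obtain ⟨i, rfl⟩ := cycleEdge_surjective hn e
    simp
  · simp

/-- A single edge together with the half-edges at the uncovered vertices is a color class. -/
theorem exists_singleClass (hn : 3 ≤ n) (hev : Even n) (j : Fin n) :
    ∃ C : ColorClass (cubicCycleLine n) 3, C.1 = fullClass hn {j} := by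
  have hA := isAlternating_even (n := n) (by omega) hev
  let c : Fin n → Fin 3 := fun i => if i = j then 0 else if Even i.val then 1 else 2
  have hc : IsCycleColoring c := by
    intro i
    have h : Even (i + 1).val ↔ ¬ Even i.val := hA i
    have hne := fin_add_one_ne (by omega) i
    by_cases hij : i = j
    · subst hij
      by_cases hi : Even i.val <;> simp [c, h, hi, hne]
    · by_cases hij' : i + 1 = j <;> by_cases hi : Even i.val <;> simp [c, h, hi, hij, hij']
  refine ⟨toClass (cycleColoring hn c hc) 0, ?_⟩
  refine (colorClass_cycleColoring hn c hc 0).trans ?_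
  congr 1
  ext i
  by_cases hij : i = j <;> by_cases hi : Even i.val <;> simp [c, hi, hij]

/-- The class of all half-edges tells them from cycle edges. The class of the single edge `k`
separates `k` from the other cycle edges and misses just the half-edges at the two ends of `k`. Two
half-edges missed by the same such classes would be at vertices with the same two cycle edges,
impossible for `n ≥ 3`. -/
theorem cycle_separation (hn : 3 ≤ n) (hev : Even n) :
    Function.Injective fun x => {C : ColorClass (cubicCycleLine n) 3 | x ∈ C.1} := by
  intro x y hxy
  have key : ∀ C : ColorClass (cubicCycleLine n) 3, x ∈ C.1 ↔ y ∈ C.1 := fun C =>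
    Set.ext_iff.1 hxy C
  obtain ⟨H, hH⟩ := exists_halfEdgeClass hn hev
  have hHk := key H
  rw [hH] at hHk
  rcases x with e | i <;> rcases y with e' | j
  · obtain ⟨i, rfl⟩ := cycleEdge_surjective hn e
    obtain ⟨j, rfl⟩ := cycleEdge_surjective hn e'
    obtain ⟨C, hC⟩ := exists_singleClass hn hev i
    have := key C
    rw [hC] at this
    simp only [inl_mem_fullClass, Set.mem_singleton_iff, true_iff] at this
    rw [this]
  · simp at hHk
  · simp at hHk
  · have single : ∀ k, (i ≠ k ∧ i - 1 ≠ k) ↔ (j ≠ k ∧ j - 1 ≠ k) := by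
      intro k
      obtain ⟨C, hC⟩ := exists_singleClass hn hev k
      have := key C
      rw [hC] at this
      simpa using this
    by_contra hne
    have hij : i ≠ j := fun h => hne (congrArg _ h)
    have h1 := single i
    have h2 := single (i - 1)
    have e1 : j - 1 = i := by
      by_contra h
      exact (h1.2 ⟨hij.symm, h⟩).1 rfl
    have e2 : j = i - 1 := by
      by_contra h
      exact (h2.2 ⟨h, fun h' => hij (sub_left_injective h').symm⟩).2 rfl
    have := fin_add_two_ne hn j
    rw [← e1] at e2
    have h3 := fin_add_two_ne hn (j - 1 - 1)
    rw [sub_add_cancel, sub_add_cancel] at h3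
    exact h3 e2

end Separation

/-! ### Edges and 3-edge-colorings of the prism -/

section Prism

variable {n : ℕ}

theorem mem_rim (b : Fin 2) (e : (cycleGraph n).edgeSet) (v : Fin n × Fin 2) :
    v ∈ (rim b e).1 ↔ v.2 = b ∧ v.1 ∈ e.1 := by
  refine Sym2.mem_map.trans ?_
  constructor
  · rintro ⟨i, hi, rfl⟩
    exact ⟨rfl, hi⟩
  · rintro ⟨rfl, h⟩
    exact ⟨v.1, h, rfl⟩

theorem mem_spoke (i : Fin n) (v : Fin n × Fin 2) : v ∈ (spoke i).1 ↔ v.1 = i := by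
  obtain ⟨j, b⟩ := v
  refine Sym2.mem_iff.trans ?_
  fin_cases b <;> simp

theorem rim_inj {b b' : Fin 2} {e e' : (cycleGraph n).edgeSet} :
    rim b e = rim b' e' ↔ b = b' ∧ e = e' := by
  constructor
  · intro h
    obtain ⟨i, hi⟩ : ∃ i, i ∈ e.1 := ⟨e.1.out.1, Sym2.out_fst_mem _⟩
    have hb : b = b' := by
      have : (i, b) ∈ (rim b' e').1 := h ▸ (mem_rim b e (i, b)).2 ⟨rfl, hi⟩
      exact ((mem_rim _ _ _).1 this).1
    subst hb
    refine ⟨rfl, Subtype.ext (Sym2.map.injective ?_ (congrArg Subtype.val h))⟩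
    intro i j hij
    exact congrArg Prod.fst hij
  · rintro ⟨rfl, rfl⟩
    rfl

theorem spoke_inj {i j : Fin n} : spoke i = spoke j ↔ i = j := by
  constructor
  · intro h
    have : (i, 0) ∈ (spoke j).1 := h ▸ (mem_spoke i (i, 0)).2 rfl
    exact (mem_spoke _ _).1 this
  · rintro rfl
    rfl

theorem rim_ne_spoke {b : Fin 2} {e : (cycleGraph n).edgeSet} {i : Fin n} : rim b e ≠ spoke i := by
  intro h
  have : (i, b + 1) ∈ (rim b e).1 := h ▸ (mem_spoke i (i, b + 1)).2 rfl
  have := ((mem_rim _ _ _).1 this).1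
  revert this
  exact (by decide : ∀ b : Fin 2, b + 1 ≠ b) b

theorem prism_edge_cases (x : (prism n).edgeSet) : (∃ b e, x = rim b e) ∨ ∃ i, x = spoke i := by
  obtain ⟨x, hx⟩ := x
  induction x using Sym2.ind with
  | _ u v =>
    obtain ⟨i, b⟩ := u
    obtain ⟨j, b'⟩ := v
    have h : ((cycleGraph n).Adj i j ∧ b = b') ∨ (completeGraph (Fin 2)).Adj b b' ∧ i = j :=
      boxProd_adj.1 hx
    rcases h with ⟨h, rfl⟩ | ⟨h, rfl⟩
    · exact Or.inl ⟨b, ⟨s(i, j), h⟩, rfl⟩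
    · refine Or.inr ⟨i, Subtype.ext ?_⟩
      have hne : b ≠ b' := h
      fin_cases b <;> fin_cases b' <;> simp_all [spoke, Sym2.eq_swap]

/-- The edges of the prism are the two copies of the cycle edges and the spokes. -/
noncomputable def prismEdgeEquiv (n : ℕ) :
    (Fin 2 × (cycleGraph n).edgeSet) ⊕ Fin n ≃ (prism n).edgeSet :=
  Equiv.ofBijective (Sum.elim (fun x => rim x.1 x.2) spoke) <| by
    constructor
    · rintro (⟨b, e⟩ | i) (⟨b', e'⟩ | j) h
      · obtain ⟨rfl, rfl⟩ := rim_inj.1 h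
        rfl
      · exact absurd h rim_ne_spoke
      · exact absurd h.symm rim_ne_spoke
      · rw [spoke_inj.1 h]
    · intro x
      rcases prism_edge_cases x with ⟨b, e, rfl⟩ | ⟨i, rfl⟩
      · exact ⟨Sum.inl (b, e), rfl⟩
      · exact ⟨Sum.inr i, rfl⟩

/-- A function on the edges of the prism that is given on the rims and on the spokes. -/
noncomputable def prismElim {α : Type*} (f : Fin 2 → (cycleGraph n).edgeSet → α) (g : Fin n → α)
    (x : (prism n).edgeSet) : α :=
  Sum.elim (fun y => f y.1 y.2) g ((prismEdgeEquiv n).symm x)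

@[simp]
theorem prismElim_rim {α : Type*} (f : Fin 2 → (cycleGraph n).edgeSet → α) (g : Fin n → α)
    (b : Fin 2) (e : (cycleGraph n).edgeSet) : prismElim f g (rim b e) = f b e :=
  congrArg (Sum.elim (fun y : Fin 2 × (cycleGraph n).edgeSet => f y.1 y.2) g)
    ((prismEdgeEquiv n).symm_apply_apply (Sum.inl (b, e)))

@[simp]
theorem prismElim_spoke {α : Type*} (f : Fin 2 → (cycleGraph n).edgeSet → α) (g : Fin n → α)
    (i : Fin n) : prismElim f g (spoke i) = g i :=
  congrArg (Sum.elim (fun y : Fin 2 × (cycleGraph n).edgeSet => f y.1 y.2) g)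
    ((prismEdgeEquiv n).symm_apply_apply (Sum.inr i))

/-- The projection of the prism to the cycle with half-edges, which maps the spokes to the
half-edges. -/
noncomputable def prismProj : (prism n).edgeSet → (cycleGraph n).edgeSet ⊕ Fin n :=
  prismElim (fun _ e => Sum.inl e) Sum.inr

@[simp]
theorem prismProj_rim (b : Fin 2) (e : (cycleGraph n).edgeSet) :
    prismProj (rim b e) = Sum.inl e := prismElim_rim _ _ _ _

@[simp]
theorem prismProj_spoke (i : Fin n) : prismProj (spoke i) = Sum.inr i := prismElim_spoke _ _ _

theorem prismProj_surjective : Function.Surjective (prismProj (n := n)) := by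
  rintro (e | i)
  · exact ⟨rim 0 e, prismProj_rim 0 e⟩
  · exact ⟨spoke i, prismProj_spoke i⟩

open Classical in
/-- The colors of the mixed coloring; the spokes have color 2. -/
noncomputable def mixedColor (x : (prism n).edgeSet) : Fin 3 :=
  prismElim (fun b e => if e ∈ evenEdges n ↔ b = 0 then 0 else 1) (fun _ => 2) x

open Classical in
@[simp]
theorem mixedColor_rim (b : Fin 2) (e : (cycleGraph n).edgeSet) :
    mixedColor (rim b e) = if e ∈ evenEdges n ↔ b = 0 then 0 else 1 := prismElim_rim _ _ _ _

@[simp]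
theorem mixedColor_spoke (i : Fin n) : mixedColor (spoke i) = 2 := prismElim_spoke _ _ _

variable [NeZero n]

/-- The three edges at a vertex of the prism. -/
def prismInc (hn : 3 ≤ n) (v : Fin n × Fin 2) : Fin 3 → (prism n).edgeSet :=
  ![rim v.2 (cycleEdge hn v.1), rim v.2 (cycleEdge hn (v.1 - 1)), spoke v.1]

@[simp]
theorem prismProj_prismInc (hn : 3 ≤ n) (v : Fin n × Fin 2) (k : Fin 3) :
    prismProj (prismInc hn v k) = cycleInc hn v.1 k := by
  fin_cases k <;> simp [prismInc, cycleInc]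

theorem mem_range_prismInc (hn : 3 ≤ n) (v : Fin n × Fin 2) (x : (prism n).edgeSet) :
    x ∈ Set.range (prismInc hn v) ↔ v ∈ x.1 := by
  rw [prismInc, mem_range_fin_three]
  rcases prism_edge_cases x with ⟨b, e, rfl⟩ | ⟨i, rfl⟩
  · obtain ⟨i, rfl⟩ := cycleEdge_surjective hn e
    rw [mem_rim, mem_cycleEdge, rim_inj, rim_inj]
    have : rim b (cycleEdge hn i) ≠ spoke v.1 := rim_ne_spoke
    tauto
  · rw [mem_spoke, spoke_inj]
    simp [rim_ne_spoke.symm, eq_comm]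

theorem isCubicLine_prism (hn : 3 ≤ n) : IsCubicLine (prism n).lineGraph (prismInc hn) where
  inj v := by
    have h := (isCubicLine_cycle hn).inj v.1
    intro k l hkl
    exact h (by simpa using congrArg prismProj hkl)
  adj x y := by
    rw [lineGraph_adj_iff_exists]
    simp only [mem_range_prismInc]
  surj x := ⟨_, (mem_range_prismInc hn _ x).2 (Sym2.out_fst_mem x.1)⟩

theorem prismInc_range_injective (hn : 3 ≤ n) (v w : Fin n × Fin 2)
    (h : Set.range (prismInc hn v) = Set.range (prismInc hn w)) : v = w := by
  have h2 : spoke v.1 ∈ Set.range (prismInc hn w) := h ▸ ⟨2, rfl⟩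
  have h0 : rim v.2 (cycleEdge hn v.1) ∈ Set.range (prismInc hn w) := h ▸ ⟨0, rfl⟩
  rw [mem_range_prismInc] at h2 h0
  exact Prod.ext ((mem_spoke _ _).1 h2).symm ((mem_rim _ _ _).1 h0).1.symm

/-- The coloring of the prism that is obtained from one of the cycle with half-edges. -/
noncomputable def liftColoring (hn : 3 ≤ n) (c : (cubicCycleLine n).Coloring (Fin 3)) :
    (prism n).lineGraph.Coloring (Fin 3) :=
  (isCubicLine_prism hn).coloring (fun x => c (prismProj x)) fun v => by
    simpa using (isCubicLine_cycle hn).injective_coloring c v.1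

theorem cycleEdge_sub_one_mem_evenEdges (hn : 3 ≤ n) (hev : Even n) (i : Fin n) :
    cycleEdge hn (i - 1) ∈ evenEdges n ↔ cycleEdge hn i ∉ evenEdges n := by
  have h := isAlternating_even (n := n) (by omega) hev (i - 1)
  rw [sub_add_cancel] at h
  have h' : Even i.val ↔ ¬ Even (i - 1).val := h
  rw [cycleEdge_mem_evenEdges, cycleEdge_mem_evenEdges, h', not_not]

theorem injective_mixedColor (hn : 3 ≤ n) (hev : Even n) (v : Fin n × Fin 2) :
    Function.Injective fun k => mixedColor (prismInc hn v k) := by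
  classical
  have : (fun k => mixedColor (prismInc hn v k)) =
      ![mixedColor (rim v.2 (cycleEdge hn v.1)), mixedColor (rim v.2 (cycleEdge hn (v.1 - 1))),
        2] := by
    ext k
    fin_cases k <;> simp [prismInc]
  rw [this]
  have h := cycleEdge_sub_one_mem_evenEdges hn hev v.1
  refine injective_fin_three ?_ ?_ ?_
  all_goals
    simp only [mixedColor_rim, h]
    by_cases h1 : cycleEdge hn v.1 ∈ evenEdges n <;> by_cases h2 : v.2 = 0 <;> simp [h1, h2]

/-- The mixed coloring of the prism. -/
noncomputable def mixedColoring (hn : 3 ≤ n) (hev : Even n) :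
    (prism n).lineGraph.Coloring (Fin 3) :=
  (isCubicLine_prism hn).coloring mixedColor (injective_mixedColor hn hev)

theorem colorClass_mixedColoring_two (hn : 3 ≤ n) (hev : Even n) :
    (mixedColoring hn hev).colorClass 2 = spokes n := by
  classical
  ext x
  change mixedColor x = 2 ↔ _
  rcases prism_edge_cases x with ⟨b, e, rfl⟩ | ⟨i, rfl⟩
  · simp only [mixedColor_rim, spokes, Set.mem_range, rim_ne_spoke.symm, exists_false, iff_false]
    split_ifs <;> decide
  · simp [spokes]

theorem colorClass_mixedColoring_castSucc (hn : 3 ≤ n) (hev : Even n) (y : Fin 2) :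
    (mixedColoring hn hev).colorClass y.castSucc = mixed n y := by
  classical
  ext x
  change mixedColor x = y.castSucc ↔ _
  rcases prism_edge_cases x with ⟨b, e, rfl⟩ | ⟨i, rfl⟩
  · rw [mixedColor_rim]
    fin_cases y <;> fin_cases b <;> by_cases h : e ∈ evenEdges n <;> simp [mixed, rim_inj, h]
  · rw [mixedColor_spoke]
    fin_cases y <;> simp [mixed, rim_ne_spoke]

theorem classes_eq_insert {V : Type*} {X : SimpleGraph V} (c : X.Coloring (Fin 3)) :
    classes c = {c.colorClass 2, c.colorClass 0, c.colorClass 1} := by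
  ext S
  constructor
  · rintro ⟨k, rfl⟩
    fin_cases k
    · exact Or.inr (Or.inl rfl)
    · exact Or.inr (Or.inr rfl)
    · exact Or.inl rfl
  · rintro (rfl | rfl | rfl)
    exacts [⟨2, rfl⟩, ⟨0, rfl⟩, ⟨1, rfl⟩]

theorem mixed_mem_colorings (hn : 3 ≤ n) (hev : Even n) :
    {spokes n, mixed n 0, mixed n 1} ∈ colorings (prism n).lineGraph 3 := by
  refine ⟨mixedColoring hn hev, (classes_eq_insert _).trans ?_⟩
  rw [colorClass_mixedColoring_two]
  exact congrArg₂ (fun S T => ({spokes n, S, T} : Set (Set (prism n).edgeSet)))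
    (colorClass_mixedColoring_castSucc hn hev 0) (colorClass_mixedColoring_castSucc hn hev 1)

/-- Here `t` is the color of a spoke, `p`, `q` and `r`, `s` those of the rim edges at its ends. Both
pairs consist of the two colors other than `t`. -/
theorem third_color_cases {p q r s t : Fin 3} (h0 : p ≠ q ∧ t ≠ p ∧ t ≠ q)
    (h1 : r ≠ s ∧ t ≠ r ∧ t ≠ s) : (q = s ∧ p = r) ∨ (q ≠ s ∧ p = s ∧ r = q) := by
  omega

/-- Two sequences of colors that agree or are swapped at each step are equal everywhere or
alternate. -/
theorem eq_or_alternating (hn : 2 ≤ n) (a : Fin 2 → Fin n → Fin 3)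
    (hnext : ∀ i : Fin n, (a 0 i = a 1 i ∧ a 0 (i + 1) = a 1 (i + 1)) ∨
      (a 0 i ≠ a 1 i ∧ a 0 (i + 1) = a 1 i ∧ a 1 (i + 1) = a 0 i)) (m : ℕ) :
    ∀ hm : m < n, (a 0 0 = a 1 0 → a 0 ⟨m, hm⟩ = a 1 ⟨m, hm⟩) ∧
      (a 0 0 ≠ a 1 0 → ∀ b, a b ⟨m, hm⟩ = if Even m ↔ b = 0 then a 0 0 else a 1 0) := by
  induction m with
  | zero =>
    intro hm
    have hz : (⟨0, hm⟩ : Fin n) = 0 := Fin.ext (Fin.val_zero n).symm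
    rw [hz]
    refine ⟨fun h => h, fun _ b => ?_⟩
    fin_cases b <;> simp
  | succ m ih =>
    intro hm
    have hm' : m < n := by omega
    have hval : (⟨m + 1, hm⟩ : Fin n) = ⟨m, hm'⟩ + 1 := by
      apply Fin.ext
      rw [fin_add_one_val (by omega)]
      exact (Nat.mod_eq_of_lt hm).symm
    obtain ⟨ih1, ih2⟩ := ih hm'
    rw [hval]
    refine ⟨fun h => ?_, fun h b => ?_⟩
    · rcases hnext ⟨m, hm'⟩ with h' | h'
      · exact h'.2
      · exact absurd (ih1 h) h'.1
    · have e0 := ih2 h 0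
      have e1 := ih2 h 1
      have hdiff : a 0 ⟨m, hm'⟩ ≠ a 1 ⟨m, hm'⟩ := by
        rw [e0, e1]
        by_cases he : Even m <;> simp [he, h, h.symm]
      rcases hnext ⟨m, hm'⟩ with h' | h'
      · exact absurd h'.1 hdiff
      · fin_cases b
        · refine h'.2.1.trans (e1.trans ?_)
          by_cases he : Even m <;> simp [he, Nat.even_add_one]
        · refine h'.2.2.trans (e0.trans ?_)
          by_cases he : Even m <;> simp [he, Nat.even_add_one]

/-- A 3-coloring of the prism is lifted from the cycle with half-edges, or it is the mixed one. -/
theorem prism_coloring_cases (hn : 3 ≤ n) (d : (prism n).lineGraph.Coloring (Fin 3)) :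
    (∃ c, d = liftColoring hn c) ∨
      ∃ s : Fin 3 → Fin 3, Function.Injective s ∧ ∀ x, d x = s (mixedColor x) := by
  classical
  let a : Fin 2 → Fin n → Fin 3 := fun b i => d (rim b (cycleEdge hn i))
  have hne : ∀ b i, a b i ≠ a b (i - 1) ∧ d (spoke i) ≠ a b i ∧ d (spoke i) ≠ a b (i - 1) := by
    intro b i
    have h := (isCubicLine_prism hn).injective_coloring d (i, b)
    exact ⟨fun e => absurd (h (a₁ := 0) (a₂ := 1) e) (by decide),
      fun e => absurd (h (a₁ := 2) (a₂ := 0) e) (by decide),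
      fun e => absurd (h (a₁ := 2) (a₂ := 1) e) (by decide)⟩
  have hspoke : ∀ b i, d (spoke i) = otherColor (a b i) (a b (i - 1)) := fun b i =>
    eq_otherColor (hne b i).1 (hne b i).2.1 (hne b i).2.2
  have hstep : ∀ i, (a 0 (i - 1) = a 1 (i - 1) ∧ a 0 i = a 1 i) ∨
      (a 0 (i - 1) ≠ a 1 (i - 1) ∧ a 0 i = a 1 (i - 1) ∧ a 1 i = a 0 (i - 1)) := by
    intro i
    exact third_color_cases (hne 0 i) (hne 1 i)
  have hnext : ∀ i : Fin n, (a 0 i = a 1 i ∧ a 0 (i + 1) = a 1 (i + 1)) ∨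
      (a 0 i ≠ a 1 i ∧ a 0 (i + 1) = a 1 i ∧ a 1 (i + 1) = a 0 i) := by
    intro i
    have := hstep (i + 1)
    rwa [add_sub_cancel_right] at this
  have hind := eq_or_alternating (by omega) a hnext
  by_cases h00 : a 0 0 = a 1 0
  · left
    have hall : ∀ b i, a b i = a 0 i := by
      intro b i
      have := (hind i.1 i.2).1 h00
      fin_cases b
      · rfl
      · exact this.symm
    have hc : IsCycleColoring (a 0) := by
      intro i
      have := (hne 0 (i + 1)).1
      rw [add_sub_cancel_right] at this
      exact this.symm
    refine ⟨cycleColoring hn (a 0) hc, RelHom.ext fun x => ?_⟩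
    rcases prism_edge_cases x with ⟨b, e, rfl⟩ | ⟨i, rfl⟩
    · obtain ⟨i, rfl⟩ := cycleEdge_surjective hn e
      have : cycleColor hn (a 0) (prismProj (rim b (cycleEdge hn i))) = a 0 i := by simp
      exact (hall b i).trans this.symm
    · have : cycleColor hn (a 0) (prismProj (spoke i)) = otherColor (a 0 i) (a 0 (i - 1)) := by
        simp
      exact (hspoke 0 i).trans this.symm
  · right
    have hall : ∀ (i : Fin n) b, a b i = if Even i.val ↔ b = 0 then a 0 0 else a 1 0 :=
      fun i => (hind i.1 i.2).2 h00
    refine ⟨![a 0 0, a 1 0, otherColor (a 0 0) (a 1 0)], injective_fin_three h00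
      (otherColor_ne_left _ _).symm (otherColor_ne_right _ _).symm, fun x => ?_⟩
    rcases prism_edge_cases x with ⟨b, e, rfl⟩ | ⟨i, rfl⟩
    · obtain ⟨i, rfl⟩ := cycleEdge_surjective hn e
      refine (hall i b).trans ?_
      rw [mixedColor_rim, cycleEdge_mem_evenEdges]
      split_ifs <;> rfl
    · rw [mixedColor_spoke]
      -- At `i`, one layer has color `a 0 0` on its rim edge `i` and the other has `a 1 0`, the
      -- parity of `i` deciding which; the spoke meets both edges.
      refine eq_otherColor h00 ?_ ?_
      · have h0 := (hne 0 i).2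
        have e0 := hall i 0
        have h1 := (hne 1 i).2
        have e1 := hall i 1
        by_cases he : Even i.val
        · simp only [he, if_true] at e0
          exact e0 ▸ h0.1
        · simp only [he, one_ne_zero, if_true] at e1
          exact e1 ▸ h1.1
      · have h0 := (hne 0 i).2
        have e0 := hall i 0
        have h1 := (hne 1 i).2
        have e1 := hall i 1
        by_cases he : Even i.val
        · simp only [he, true_iff, one_ne_zero, if_false] at e1
          exact e1 ▸ h1.1
        · simp only [he, false_iff, not_true_eq_false, if_false] at e0
          exact e0 ▸ h0.1

end Prism

/-! ### The coloring complex of the prism: a triangle added to that of the cycle -/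

section Embedding

variable {n : ℕ}

theorem exists_mixedColor_rim_eq (e : (cycleGraph n).edgeSet) {l : Fin 3} (hl : l ≠ 2) :
    ∃ b, mixedColor (rim b e) = l := by
  classical
  have hl' : l = 0 ∨ l = 1 := by omega
  rcases hl' with rfl | rfl <;> by_cases he : e ∈ evenEdges n
  · exact ⟨0, by simp [he]⟩
  · exact ⟨1, by simp [he]⟩
  · exact ⟨1, by simp [he]⟩
  · exact ⟨0, by simp [he]⟩

variable [NeZero n]

/-- The color class of the prism that corresponds to a color class of the cycle with
half-edges. -/
def liftClass (hn : 3 ≤ n) (C : ColorClass (cubicCycleLine n) 3) :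
    ColorClass (prism n).lineGraph 3 :=
  ⟨prismProj ⁻¹' C.1, by
    obtain ⟨c, k, rfl⟩ := exists_eq_toClass C
    exact ⟨classes (liftColoring hn c), ⟨_, rfl⟩, k, rfl⟩⟩

theorem mem_liftClass (hn : 3 ≤ n) (C : ColorClass (cubicCycleLine n) 3) (x : (prism n).edgeSet) :
    x ∈ (liftClass hn C).1 ↔ prismProj x ∈ C.1 := Iff.rfl

theorem liftClass_injective (hn : 3 ≤ n) : Function.Injective (liftClass hn) := fun _ _ h =>
  Subtype.ext (prismProj_surjective.preimage_injective (congrArg Subtype.val h))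

/-- The color classes of the mixed coloring. -/
noncomputable abbrev mixedClass (hn : 3 ≤ n) (hev : Even n) (k : Fin 3) :
    ColorClass (prism n).lineGraph 3 := toClass (mixedColoring hn hev) k

theorem mixedClass_injective (hn : 3 ≤ n) (hev : Even n) :
    Function.Injective (mixedClass hn hev) := (isCubicLine_prism hn).toClass_injective _

theorem liftClass_eq_spokes (hn : 3 ≤ n) {H : ColorClass (cubicCycleLine n) 3}
    (hH : H.1 = Set.range Sum.inr) : (liftClass hn H).1 = spokes n := by
  ext x
  change prismProj x ∈ H.1 ↔ _
  rw [hH]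
  rcases prism_edge_cases x with ⟨b, e, rfl⟩ | ⟨i, rfl⟩
  · simp [spokes, rim_ne_spoke.symm]
  · simp [spokes]

theorem liftClass_eq_mixedClass (hn : 3 ≤ n) (hev : Even n)
    {H : ColorClass (cubicCycleLine n) 3} (hH : H.1 = Set.range Sum.inr) :
    liftClass hn H = mixedClass hn hev 2 :=
  Subtype.ext ((liftClass_eq_spokes hn hH).trans (colorClass_mixedColoring_two hn hev).symm)

/-- A lifted class contains both copies of a cycle edge or neither, while a mixed class other than
the spokes contains exactly one. -/
theorem liftClass_ne_mixedClass (hn : 3 ≤ n) (hev : Even n) (C : ColorClass (cubicCycleLine n) 3)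
    {k : Fin 3} (hk : k ≠ 2) : liftClass hn C ≠ mixedClass hn hev k := by
  classical
  intro h
  have h0 : ∀ b, prismProj (rim b (cycleEdge hn 0)) ∈ C.1 ↔
      mixedColor (rim b (cycleEdge hn 0)) = k := fun b =>
    Set.ext_iff.1 (congrArg Subtype.val h) (rim b (cycleEdge hn 0))
  have h1 := (h0 0).symm.trans (by simpa using h0 1)
  simp only [mixedColor_rim, cycleEdge_mem_evenEdges] at h1
  revert hk h1
  fin_cases k <;> simp

theorem eq_of_liftClass_eq_mixedClass (hn : 3 ≤ n) (hev : Even n)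
    {H C : ColorClass (cubicCycleLine n) 3} (hH : H.1 = Set.range Sum.inr) {k : Fin 3}
    (h : liftClass hn C = mixedClass hn hev k) : C = H := by
  by_cases hk : k = 2
  · subst hk
    exact liftClass_injective hn (h.trans (liftClass_eq_mixedClass hn hev hH).symm)
  · exact absurd h (liftClass_ne_mixedClass hn hev C hk)

theorem toClass_cases (hn : 3 ≤ n) (hev : Even n) (d : (prism n).lineGraph.Coloring (Fin 3)) :
    (∃ c, ∀ k, toClass d k = liftClass hn (toClass c k)) ∨
      ∀ k, ∃ l, toClass d k = mixedClass hn hev l := by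
  rcases prism_coloring_cases hn d with ⟨c, rfl⟩ | ⟨s, hs, hd⟩
  · exact Or.inl ⟨c, fun k => rfl⟩
  · refine Or.inr fun k => ?_
    obtain ⟨l, rfl⟩ := Finite.injective_iff_surjective.1 hs k
    refine ⟨l, Subtype.ext (Set.ext fun x => ?_)⟩
    change d x = s l ↔ mixedColor x = l
    rw [hd, hs.eq_iff]

theorem prism_class_cases (hn : 3 ≤ n) (hev : Even n) (D : ColorClass (prism n).lineGraph 3) :
    (∃ C, D = liftClass hn C) ∨ ∃ k, D = mixedClass hn hev k := by
  obtain ⟨d, k, rfl⟩ := exists_eq_toClass D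
  rcases toClass_cases hn hev d with ⟨c, hc⟩ | h
  · exact Or.inl ⟨_, hc k⟩
  · exact Or.inr (h k)

/-- The mixed coloring contains only one lifted class, the spokes. So a coloring with two distinct
lifted classes is itself lifted. -/
theorem liftClass_adj_iff (hn : 3 ≤ n) (hev : Even n) {C D : ColorClass (cubicCycleLine n) 3} :
    (complex (prism n).lineGraph 3).Adj (liftClass hn C) (liftClass hn D) ↔
      (complex (cubicCycleLine n) 3).Adj C D := by
  obtain ⟨H, hH⟩ := exists_halfEdgeClass hn hev
  rw [complex_adj_iff, complex_adj_iff, (liftClass_injective hn).ne_iff]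
  refine and_congr_right fun hne => ?_
  constructor
  · rintro ⟨d, i, j, hi, hj⟩
    rcases toClass_cases hn hev d with ⟨c, hc⟩ | h
    · exact ⟨c, i, j, liftClass_injective hn (hi.trans (hc i)),
        liftClass_injective hn (hj.trans (hc j))⟩
    · obtain ⟨k, hk⟩ := h i
      obtain ⟨l, hl⟩ := h j
      exact absurd ((eq_of_liftClass_eq_mixedClass hn hev hH (hi.trans hk)).trans
        (eq_of_liftClass_eq_mixedClass hn hev hH (hj.trans hl)).symm) hne
  · rintro ⟨c, i, j, rfl, rfl⟩
    exact ⟨liftColoring hn c, i, j, rfl, rfl⟩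

theorem mixedClass_adj_iff (hn : 3 ≤ n) (hev : Even n) {k l : Fin 3} :
    (complex (prism n).lineGraph 3).Adj (mixedClass hn hev k) (mixedClass hn hev l) ↔ k ≠ l := by
  rw [complex_adj_iff, (mixedClass_injective hn hev).ne_iff]
  exact and_iff_left ⟨mixedColoring hn hev, k, l, rfl, rfl⟩

theorem liftClass_adj_mixedClass_iff (hn : 3 ≤ n) (hev : Even n)
    {H C : ColorClass (cubicCycleLine n) 3} (hH : H.1 = Set.range Sum.inr) {k : Fin 3}
    (hk : k ≠ 2) :
    (complex (prism n).lineGraph 3).Adj (liftClass hn C) (mixedClass hn hev k) ↔ C = H := by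
  constructor
  · intro h
    obtain ⟨-, d, i, j, hi, hj⟩ := complex_adj_iff.1 h
    rcases toClass_cases hn hev d with ⟨c, hc⟩ | h
    · exact absurd (hj.trans (hc j)).symm (liftClass_ne_mixedClass hn hev _ hk)
    · obtain ⟨l, hl⟩ := h i
      exact eq_of_liftClass_eq_mixedClass hn hev hH (hi.trans hl)
  · rintro rfl
    rw [liftClass_eq_mixedClass hn hev hH, mixedClass_adj_iff]
    exact hk.symm

theorem castSucc_ne_two (x : Fin 2) : x.castSucc ≠ (2 : Fin 3) := by
  fin_cases x <;> decide

/-- The coloring complex of the prism is that of the cycle with half-edges together with a triangle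
at the class of all half-edges. -/
noncomputable def complexIso (hn : 3 ≤ n) (hev : Even n) (H : ColorClass (cubicCycleLine n) 3)
    (hH : H.1 = Set.range Sum.inr) :
    addTriangle (complex (cubicCycleLine n) 3) H ≃g complex (prism n).lineGraph 3 where
  toEquiv := Equiv.ofBijective
    (Sum.elim (liftClass hn) fun x : Fin 2 => mixedClass hn hev x.castSucc) <| by
      constructor
      · rintro (C | x) (D | y) h
        · exact congrArg _ (liftClass_injective hn h)
        · exact absurd h (liftClass_ne_mixedClass hn hev C (castSucc_ne_two y))
        · exact absurd h.symm (liftClass_ne_mixedClass hn hev D (castSucc_ne_two x))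
        · exact congrArg _ (Fin.castSucc_injective 2 (mixedClass_injective hn hev h))
      · intro D
        rcases prism_class_cases hn hev D with ⟨C, rfl⟩ | ⟨k, rfl⟩
        · exact ⟨Sum.inl C, rfl⟩
        · fin_cases k
          · exact ⟨Sum.inr 0, rfl⟩
          · exact ⟨Sum.inr 1, rfl⟩
          · exact ⟨Sum.inl H, liftClass_eq_mixedClass hn hev hH⟩
  map_rel_iff' := by
    rintro (C | x) (D | y)
    · exact liftClass_adj_iff hn hev
    · exact liftClass_adj_mixedClass_iff hn hev hH (castSucc_ne_two y)
    · exact (adj_comm _ _ _).trans (liftClass_adj_mixedClass_iff hn hev hH (castSucc_ne_two x))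
    · exact (mixedClass_adj_iff hn hev).trans (Fin.castSucc_injective 2).ne_iff

theorem complexIso_inl (hn : 3 ≤ n) (hev : Even n) (H : ColorClass (cubicCycleLine n) 3)
    (hH : H.1 = Set.range Sum.inr) (C : ColorClass (cubicCycleLine n) 3) :
    complexIso hn hev H hH (Sum.inl C) = liftClass hn C := rfl

/-! ### The 3-colorings of the prism complex are the stars -/

theorem prism_separation (hn : 3 ≤ n) (hev : Even n) :
    Function.Injective fun x => {D : ColorClass (prism n).lineGraph 3 | x ∈ D.1} := by
  classical
  intro x y hxy
  have key : ∀ D : ColorClass (prism n).lineGraph 3, x ∈ D.1 ↔ y ∈ D.1 := fun D =>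
    Set.ext_iff.1 hxy D
  -- Lifted classes determine an edge up to its layer; the mixed classes then tell the two copies of
  -- a rim edge apart.
  have hproj : prismProj x = prismProj y :=
    cycle_separation hn hev (Set.ext fun C => key (liftClass hn C))
  have hmix : mixedColor x = mixedColor y :=
    ((key (mixedClass hn hev (mixedColor x))).1 rfl).symm
  rcases prism_edge_cases x with ⟨b, e, rfl⟩ | ⟨i, rfl⟩ <;>
    rcases prism_edge_cases y with ⟨b', e', rfl⟩ | ⟨j, rfl⟩
  · rw [prismProj_rim, prismProj_rim] at hproj
    obtain rfl := Sum.inl_injective hproj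
    rw [mixedColor_rim, mixedColor_rim] at hmix
    have : b = b' := by
      revert hmix
      by_cases he : e ∈ evenEdges n <;> fin_cases b <;> fin_cases b' <;> simp [he]
    rw [this]
  · rw [prismProj_rim, prismProj_spoke] at hproj
    exact absurd hproj (by simp)
  · rw [prismProj_rim, prismProj_spoke] at hproj
    exact absurd hproj (by simp)
  · rw [prismProj_spoke, prismProj_spoke] at hproj
    rw [Sum.inr_injective hproj]

theorem cycle_star (hn : 3 ≤ n) (hev : Even n)
    (f : (complex (cubicCycleLine n) 3).Coloring (Fin 3)) :
    ∃ i, classes f = classes ((isCubicLine_cycle hn).star i) := by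
  obtain ⟨i, p, hp, hf⟩ := cycle_classes_eq_star hn hev f
  exact ⟨i, (isCubicLine_cycle hn).classes_eq_star i f p hp hf⟩

/-- Every 3-coloring of the coloring complex of the prism comes from a vertex. -/
theorem prism_star (hn : 3 ≤ n) (hev : Even n)
    (f : (complex (prism n).lineGraph 3).Coloring (Fin 3)) :
    ∃ v, classes f = classes ((isCubicLine_prism hn).star v) := by
  obtain ⟨H, hH⟩ := exists_halfEdgeClass hn hev
  let f' : (complex (cubicCycleLine n) 3).Coloring (Fin 3) :=
    Coloring.mk (fun C => f (liftClass hn C)) fun h => f.valid ((liftClass_adj_iff hn hev).2 h)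
  obtain ⟨i, p, hp, hf⟩ := cycle_classes_eq_star hn hev f'
  have hlift : ∀ C k, cycleInc hn i k ∈ C.1 → f (liftClass hn C) = p k := hf
  have hm : Function.Injective fun k => f (mixedClass hn hev k) := by
    intro k l hkl
    by_contra hne
    exact f.valid ((mixedClass_adj_iff hn hev).2 hne) hkl
  have hm2 : f (mixedClass hn hev 2) = p 2 := by
    rw [← liftClass_eq_mixedClass hn hev hH]
    exact hlift H 2 (hH ▸ ⟨i, rfl⟩)
  -- The layer `b` is chosen such that the mixed class containing the copy of the cycle edge `i` in
  -- layer `b` has the color `p 0`, which the star at `i` prescribes for that edge.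
  obtain ⟨l, hl⟩ := Finite.injective_iff_surjective.1 hm (p 0)
  have hl' : f (mixedClass hn hev l) = p 0 := hl
  have hl2 : l ≠ 2 := by
    rintro rfl
    exact absurd (hp (hm2.symm.trans hl')) (by decide)
  obtain ⟨b, hb⟩ := exists_mixedColor_rim_eq (cycleEdge hn i) hl2
  refine ⟨(i, b), (isCubicLine_prism hn).classes_eq_star (i, b) f p hp ?_⟩
  intro D k hk
  rcases prism_class_cases hn hev D with ⟨C, rfl⟩ | ⟨l', rfl⟩
  · rw [mem_liftClass, prismProj_prismInc] at hk
    exact hlift C k hk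
  · have hk' : mixedColor (prismInc hn (i, b) k) = l' := hk
    have hmixinj := injective_mixedColor hn hev (i, b)
    have e0 : mixedColor (prismInc hn (i, b) 0) = l := hb
    have e2 : mixedColor (prismInc hn (i, b) 2) = 2 := mixedColor_spoke i
    subst hk'
    have hk012 : k = 0 ∨ k = 2 ∨ k = 1 := by omega
    rcases hk012 with rfl | rfl | rfl
    · rw [e0, hl']
    · rw [e2, hm2]
    -- The colors `p 0` and `p 2` are taken by the other two mixed classes, which leaves `p 1`.
    · obtain ⟨k, hk⟩ := Finite.injective_iff_surjective.1 hp
        (f (mixedClass hn hev (mixedColor (prismInc hn (i, b) 1))))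
      have hk0 : k ≠ 0 := by
        rintro rfl
        exact absurd (hmixinj (a₁ := 1) (a₂ := 0) ((hm (hk.symm.trans hl'.symm)).trans e0.symm))
          (by decide)
      have hk2 : k ≠ 2 := by
        rintro rfl
        exact absurd (hmixinj (a₁ := 1) (a₂ := 2) ((hm (hk.symm.trans hm2.symm)).trans e2.symm))
          (by decide)
      have : k = 1 := by omega
      rw [← hk, this]

/-- If a 3-coloring extends another one, its restriction to the smaller graph is that one. -/
theorem preimage_classes_of_extends {V W : Type*} {X : SimpleGraph V} {Y : SimpleGraph W}
    {j : V → W} {P : Set (Set V)} {Q : Set (Set W)} (h : Extends X Y j P Q) :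
    P = Set.preimage j '' Q := by
  obtain ⟨c, d, rfl, rfl, hcd⟩ := h
  have hval : ∀ v, d (j v) = c v := fun v => hcd (c v) ⟨v, rfl, rfl⟩
  have : ∀ i, c.colorClass i = j ⁻¹' d.colorClass i := by
    intro i
    ext v
    change c v = i ↔ d (j v) = i
    rw [hval]
  rw [classes, classes, ← Set.range_comp]
  exact congrArg Set.range (funext this)

/-- `prismProj` maps the edges at `v` to those at `v.1`, so the star of `v` restricts to the star of
`v.1`; stars of distinct vertices of the cycle differ. -/
theorem extends_star_iff (hn : 3 ≤ n) (hev : Even n) (i : Fin n) (v : Fin n × Fin 2) :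
    Extends (complex (cubicCycleLine n) 3) (complex (prism n).lineGraph 3) (liftClass hn)
      (classes ((isCubicLine_cycle hn).star i)) (classes ((isCubicLine_prism hn).star v)) ↔
      v.1 = i := by
  constructor
  · intro h
    apply (isCubicLine_cycle hn).star_injective (cycle_separation hn hev)
      (cycleInc_range_injective hn)
    refine Eq.trans ?_ (preimage_classes_of_extends h).symm
    change classes _ = _
    rw [IsCubicLine.classes_star, IsCubicLine.classes_star, ← Set.range_comp]
    refine congrArg Set.range (funext fun k => Set.ext fun C => ?_)
    change cycleInc hn v.1 k ∈ C.1 ↔ prismProj (prismInc hn v k) ∈ C.1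
    rw [prismProj_prismInc]
  · rintro rfl
    refine ⟨_, _, rfl, rfl, fun k => ?_⟩
    rw [IsCubicLine.colorClass_star, IsCubicLine.colorClass_star]
    rintro _ ⟨C, hC, rfl⟩
    change prismProj (prismInc hn v k) ∈ C.1
    rw [prismProj_prismInc]
    exact hC

theorem ncard_extensions (hn : 3 ≤ n) (hev : Even n)
    {P : Set (Set (ColorClass (cubicCycleLine n) 3))}
    (hP : P ∈ colorings (complex (cubicCycleLine n) 3) 3) :
    {Q ∈ colorings (complex (prism n).lineGraph 3) 3 |
      Extends (complex (cubicCycleLine n) 3) (complex (prism n).lineGraph 3)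
        (liftClass hn) P Q}.ncard = 2 := by
  rw [(isCubicLine_cycle hn).colorings_complex (cycle_star hn hev)] at hP
  obtain ⟨i, rfl⟩ := hP
  have hinj := (isCubicLine_prism hn).star_injective (prism_separation hn hev)
    (prismInc_range_injective hn)
  have : {Q ∈ colorings (complex (prism n).lineGraph 3) 3 |
      Extends (complex (cubicCycleLine n) 3) (complex (prism n).lineGraph 3)
        (liftClass hn) (classes ((isCubicLine_cycle hn).star i)) Q} =
      Set.range fun b : Fin 2 => classes ((isCubicLine_prism hn).star (i, b)) := by
    ext Q
    rw [(isCubicLine_prism hn).colorings_complex (prism_star hn hev)]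
    constructor
    · rintro ⟨⟨v, rfl⟩, h⟩
      obtain rfl := (extends_star_iff hn hev i v).1 h
      exact ⟨v.2, rfl⟩
    · rintro ⟨b, rfl⟩
      exact ⟨⟨(i, b), rfl⟩, (extends_star_iff hn hev i (i, b)).2 rfl⟩
  rw [this, Set.ncard_range_of_injective, Nat.card_eq_fintype_card, Fintype.card_fin]
  intro b b' h
  exact congrArg Prod.snd (hinj h)

end Embedding

end ColoringComplex

open ColoringComplex
theorem theorem4p1 (n : ℕ) (hn : 4 ≤ n) (hev : Even n) :
    IsEdgeReflexive (prism n) ∧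
    -- the spokes and the two mixed classes form a 3-coloring, the mixed coloring
    {spokes n, mixed n 0, mixed n 1} ∈ colorings (prism n).lineGraph 3 ∧
    ∃ (v : ColorClass (cubicCycleLine n) 3)
      (Φ : addTriangle (complex (cubicCycleLine n) 3) v ≃g complex (prism n).lineGraph 3),
      -- the extra triangle is attached at the class of all half-edges,
      -- which corresponds to the class of all spokes
      v.1 = Set.range Sum.inr ∧
      (Φ (Sum.inl v)).1 = spokes n ∧
      -- the other two vertices of the extra triangle are the classes of the mixed coloring
      (∀ x : Fin 2, (Φ (Sum.inr x)).1 = mixed n x) ∧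
      -- every color class of the cubic cycle corresponds to the class of the prism that consists
      -- of both copies of its cycle edges and the spokes at its half-edges
      (∀ C : ColorClass (cubicCycleLine n) 3,
        (∀ (b : Fin 2) (e : (cycleGraph n).edgeSet),
          rim b e ∈ (Φ (Sum.inl C)).1 ↔ Sum.inl e ∈ C.1) ∧
        ∀ i : Fin n, spoke i ∈ (Φ (Sum.inl C)).1 ↔ Sum.inr i ∈ C.1) ∧
      (colorings (complex (cubicCycleLine n) 3) 3).ncard = n ∧
      (∀ P ∈ colorings (complex (cubicCycleLine n) 3) 3,
        {Q ∈ colorings (complex (prism n).lineGraph 3) 3 |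
          Extends (complex (cubicCycleLine n) 3) (complex (prism n).lineGraph 3)
            (fun C => Φ (Sum.inl C)) P Q}.ncard = 2) ∧
      (colorings (complex (prism n).lineGraph 3) 3).ncard = 2 * n := by
  have hn3 : 3 ≤ n := by omega
  have : NeZero n := ⟨by omega⟩
  obtain ⟨H, hH⟩ := exists_halfEdgeClass hn3 hev
  refine ⟨⟨⟨mixedColoring hn3 hev⟩,
    (isCubicLine_prism hn3).isReflexive (prism_separation hn3 hev) (prism_star hn3 hev)⟩,
    mixed_mem_colorings hn3 hev, H, complexIso hn3 hev H hH, hH, liftClass_eq_spokes hn3 hH,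
    fun x => colorClass_mixedColoring_castSucc hn3 hev x, fun C => ⟨fun b e => ?_, fun i => ?_⟩,
    ?_, fun P hP => ncard_extensions hn3 hev hP, ?_⟩
  · rw [complexIso_inl, mem_liftClass, prismProj_rim]
  · rw [complexIso_inl, mem_liftClass, prismProj_spoke]
  · rw [(isCubicLine_cycle hn3).ncard_colorings_complex (cycle_separation hn3 hev)
      (cycleInc_range_injective hn3) (cycle_star hn3 hev), Nat.card_eq_fintype_card,
      Fintype.card_fin]
  · rw [(isCubicLine_prism hn3).ncard_colorings_complex (prism_separation hn3 hev)
      (prismInc_range_injective hn3) (prism_star hn3 hev), Nat.card_prod,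
      Nat.card_eq_fintype_card, Nat.card_eq_fintype_card, Fintype.card_fin, Fintype.card_fin,
      mul_comm]
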